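/- **Setting.** Let $M$ be a Hausdorff, second countable smooth manifold of dimension $d$ (for spacetimes $d=4$), with a smooth Lorentzian metric $g$ of signature $(-,+,\dots,+)$ and a time orientation. For $A\subseteq M$ let $J^{\pm}(A)$ be the set of points that lie in $A$ or can be reached from a point of $A$ by a piecewise smooth future-directed ($+$) or past-directed ($-$) causal curve, and put $J(A)=J^+(A)\cup J^-(A)$. Assume that $(M,g)$ is globally hyperbolic: it is strongly causal (every point has arbitrarily small causally convex open neighbourhoods) and $J^+(p)\cap J^-(q)$ is compact (possibly empty) for all $p,q\in M$. Let $E\to M$ be a smooth real vector bundle of finite rank with a smooth non-degenerate fibrewise bilinear form $\langle\cdot,\cdot\rangle$ that is either symmetric or antisymmetric. Let $\Gamma(M,E)$ be the space of smooth sections, $\Gamma_0(M,E)$ the subspace of sections with compact support, and $\Gamma_{sc}(M,E)$ the subspace of sections whose support is contained in $J(K)$ for some compact $K\subseteq M$. Put $(\sigma,\tau)=\int_M\langle\sigma,\tau\rangle\,\mathrm{vol}_M$ whenever $\mathrm{supp}\,\sigma\cap\mathrm{supp}\,\tau$ is compact, where $\mathrm{vol}_M$ is the volume measure of $g$. Let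 $P:\Gamma(M,E)\to\Gamma(M,E)$ be a linear partial differential operator with smooth coefficients. A formal adjoint of $P$ is a linear partial differential operator $P^*$ on $\Gamma(M,E)$ with $(P^*u,v)=(u,Pv)$ for all $u,v\in\Gamma(M,E)$ such that $\mathrm{supp}\,u\cap\mathrm{supp}\,v$ is compact. An advanced ($+$) or retarded ($-$) Green operator for $P$ is a linear map $G^\pm:\Gamma_0(M,E)\to\Gamma(M,E)$ such that, for every $f\in\Gamma_0(M,E)$, $$PG^\pm f=f,\qquad G^\pm Pf=f,\qquad \mathrm{supp}(G^\pm f)\subseteq J^\pm(\mathrm{supp}\,f).$$ $P$ is called Green-hyperbolic if it admits an advanced and a retarded Green operator. **Proposition 3.2.** Let $P$ be Green-hyperbolic with Green-hyperbolic formal adjoint $P^*$. Let $G^+$ and $G^-$ be advanced and retarded Green operators for $P$, and let $G=G^+-G^-:\Gamma_0(M,E)\to\Gamma_{sc}(M,E)$ be the causal propagator. Then 1. $\ker G=P(\Gamma_0(M,E))$; 2. $G(\Gamma_0(M,E))=\{u\in\Gamma_{sc}(M,E): Pu=0\}$. Moreover, $P$ is injective on $\Gamma_0(M,E)$. -/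

import Mathlib

open Set Filter MeasureTheory Bundle
open scoped Manifold ContDiff Topology

noncomputable section

/-! ### Time-oriented Lorentzian manifolds and their causal structure -/

section Spacetimes

variable (d : ℕ) (M : Type*) [TopologicalSpace M] [ChartedSpace (EuclideanSpace ℝ (Fin d)) M]
  [IsManifold (𝓡 d) ∞ M]

/-- A smooth Lorentzian metric of signature `(-,+,…,+)` on the `d`-dimensional manifold `M`. -/
structure LorentzMetric where
  /-- the bilinear form on each tangent space -/
  val : ∀ x : M, TangentSpace (𝓡 d) x →L[ℝ] TangentSpace (𝓡 d) x →L[ℝ] ℝ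
  symm : ∀ (x : M) (v w : TangentSpace (𝓡 d) x), val x v w = val x w v
  /-- there is a timelike vector on whose orthogonal complement the form is positive definite -/
  lorentzian : ∀ x : M, ∃ v : TangentSpace (𝓡 d) x, val x v v < 0 ∧
    ∀ w : TangentSpace (𝓡 d) x, val x v w = 0 → w ≠ 0 → 0 < val x w w
  contMDiff : ContMDiff (𝓡 d)
    ((𝓡 d).prod 𝓘(ℝ, EuclideanSpace ℝ (Fin d) →L[ℝ] EuclideanSpace ℝ (Fin d) →L[ℝ] ℝ)) ∞
    (fun x : M => TotalSpace.mk'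
      (EuclideanSpace ℝ (Fin d) →L[ℝ] EuclideanSpace ℝ (Fin d) →L[ℝ] ℝ)
      (E := fun x : M => TangentSpace (𝓡 d) x →L[ℝ] TangentSpace (𝓡 d) x →L[ℝ] ℝ) x (val x))

/-- A Lorentzian metric together with a time orientation, given by a smooth vector field which is
everywhere timelike (and by definition future-directed). -/
structure SpacetimeStructure where
  /-- the metric -/
  g : LorentzMetric d M
  /-- the future-directed timelike vector field -/
  timeField : Cₛ^∞⟮𝓡 d; EuclideanSpace ℝ (Fin d), (TangentSpace (𝓡 d) : M → Type _)⟯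
  timelike : ∀ x : M, g.val x (timeField x) (timeField x) < 0

namespace SpacetimeStructure

variable {d M} (S : SpacetimeStructure d M)

/-- `v` is a nonzero causal (timelike or lightlike) vector in the future fold of the light cone.
(A causal vector with `g(T, v) < 0` is automatically nonzero, since `g(T, 0) = 0`.) -/
def IsFutureCausal {x : M} (v : TangentSpace (𝓡 d) x) : Prop :=
  S.g.val x v v ≤ 0 ∧ S.g.val x (S.timeField x) v < 0

/-- There is a smooth future-directed causal curve `γ : [a, b] → M` from `p` to `q`
(smoothness on `[a, b]` means, as usual, smoothness in a neighbourhood of each of its points). -/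
def SmoothCausalArc (p q : M) : Prop :=
  ∃ (γ : ℝ → M) (a b : ℝ), a < b ∧ γ a = p ∧ γ b = q ∧
    ∀ t ∈ Icc a b, ContMDiffAt 𝓘(ℝ, ℝ) (𝓡 d) ∞ γ t ∧
      S.IsFutureCausal (x := γ t) (mfderiv 𝓘(ℝ, ℝ) (𝓡 d) γ t (1 : ℝ))

/-- `p ≤ q`: either `p = q`, or `q` is reached from `p` along a piecewise smooth future-directed
causal curve, that is, along a finite concatenation of smooth future-directed causal arcs. -/
def CausallyPrecedes : M → M → Prop := Relation.ReflTransGen S.SmoothCausalArc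

/-- The causal future `J⁺(A)` of a set. -/
def causalFuture (A : Set M) : Set M := {q | ∃ p ∈ A, S.CausallyPrecedes p q}

/-- The causal past `J⁻(A)` of a set. -/
def causalPast (A : Set M) : Set M := {q | ∃ p ∈ A, S.CausallyPrecedes q p}

/-- `J(A) = J⁺(A) ∪ J⁻(A)`. -/
def causalInfluence (A : Set M) : Set M := S.causalFuture A ∪ S.causalPast A

/-- `U` is causally convex: no causal curve leaves `U` and comes back to it. -/
def IsCausallyConvex (U : Set M) : Prop :=
  ∀ p ∈ U, ∀ q ∈ U, S.causalFuture {p} ∩ S.causalPast {q} ⊆ U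

/-- Every point has arbitrarily small causally convex open neighbourhoods. -/
def IsStronglyCausal : Prop :=
  ∀ p : M, ∀ U ∈ 𝓝 p, ∃ V : Set M, IsOpen V ∧ p ∈ V ∧ V ⊆ U ∧ S.IsCausallyConvex V

/-- Global hyperbolicity: strong causality together with compactness of all the causal diamonds
`J⁺(p) ∩ J⁻(q)`. -/
def IsGloballyHyperbolic : Prop :=
  S.IsStronglyCausal ∧ ∀ p q : M, IsCompact (S.causalFuture {p} ∩ S.causalPast {q})

/-- A region is spacelike-compact if it is contained in `J(K)` for some compact `K`. -/
def IsSpacelikeCompact (Ω : Set M) : Prop :=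
  ∃ K : Set M, IsCompact K ∧ Ω ⊆ S.causalInfluence K

theorem causalInfluence_mono {A B : Set M} (h : A ⊆ B) :
    S.causalInfluence A ⊆ S.causalInfluence B := by
  rintro q (⟨p, hp, hq⟩ | ⟨p, hp, hq⟩)
  · exact Or.inl ⟨p, h hp, hq⟩
  · exact Or.inr ⟨p, h hp, hq⟩

end SpacetimeStructure

/-! ### The volume measure of a Lorentzian metric -/

namespace LorentzMetric

variable {d M} (g : LorentzMetric d M)

/-- The matrix `g_{ij} = g(∂_i, ∂_j)` of the metric in the chart `e`, at the coordinates `z`. -/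
def coordMatrix (e : OpenPartialHomeomorph M (EuclideanSpace ℝ (Fin d)))
    (z : EuclideanSpace ℝ (Fin d)) : Matrix (Fin d) (Fin d) ℝ :=
  Matrix.of fun i j => g.val (e.symm z)
    (mfderiv (𝓡 d) (𝓡 d) e.symm z (EuclideanSpace.single i (1 : ℝ)))
    (mfderiv (𝓡 d) (𝓡 d) e.symm z (EuclideanSpace.single j (1 : ℝ)))

variable (d M) in
/-- A smooth partition of unity on `M` whose `x`-th function is supported in the domain of the
preferred chart at `x`. -/
def chartPartition [T2Space M] [SecondCountableTopology M] :
    SmoothPartitionOfUnity M (𝓡 d) M univ :=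
  haveI : LocallyCompactSpace M := ChartedSpace.locallyCompactSpace (EuclideanSpace ℝ (Fin d)) M
  (SmoothPartitionOfUnity.exists_isSubordinate_chartAt_source (𝓡 d) M).choose

variable (d M) in
theorem chartPartition_isSubordinate [T2Space M] [SecondCountableTopology M] :
    (chartPartition d M).IsSubordinate
      fun x => (chartAt (EuclideanSpace ℝ (Fin d)) x).source :=
  haveI : LocallyCompactSpace M := ChartedSpace.locallyCompactSpace (EuclideanSpace ℝ (Fin d)) M
  (SmoothPartitionOfUnity.exists_isSubordinate_chartAt_source (𝓡 d) M).choose_spec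

variable [MeasurableSpace M] [BorelSpace M]

/-- The volume measure on the domain of the chart `e` (extended by zero to `M`): in coordinates,
it is `√|det g_{ij}| dz¹ … dzᵈ`. -/
def chartVolume (e : OpenPartialHomeomorph M (EuclideanSpace ℝ (Fin d))) : Measure M :=
  (((volume : Measure (EuclideanSpace ℝ (Fin d))).restrict e.target).withDensity
    (fun z => ENNReal.ofReal (Real.sqrt |(g.coordMatrix e z).det|))).map e.symm

/-- The volume measure `vol_M` of the metric, glued from the local expressions `√|det g_{ij}| dz`
by a partition of unity `(ρ_x)` subordinate to a cover by charts:
`∫_M f vol_M = ∑_x ∫ ρ_x f √|det g_{ij}| dz`. By the change of variables formula the measure does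
not depend on the charts and on the partition of unity. -/
def volumeMeasure [T2Space M] [SecondCountableTopology M] : Measure M :=
  Measure.sum fun x : M => (g.chartVolume (chartAt (EuclideanSpace ℝ (Fin d)) x)).withDensity
    fun y => ENNReal.ofReal (chartPartition d M x y)

end LorentzMetric

end Spacetimes

/-! ### Sections of a vector bundle, their supports, fibrewise bilinear forms -/

section Sections

variable (d : ℕ) {M : Type*} [TopologicalSpace M] [ChartedSpace (EuclideanSpace ℝ (Fin d)) M]
  (F : Type*) [NormedAddCommGroup F] [NormedSpace ℝ F]
  (V : M → Type*) [TopologicalSpace (TotalSpace F V)] [∀ x, TopologicalSpace (V x)]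
  [∀ x, AddCommGroup (V x)] [∀ x, Module ℝ (V x)]
  [FiberBundle F V] [VectorBundle ℝ F V]

/-- `Γ(M, V)`: the vector space of smooth sections of the vector bundle `V` with typical
fibre `F`. -/
abbrev Sections := Cₛ^∞⟮𝓡 d; F, V⟯

variable {d F V}

/-- The support of a section: the closure of the set where it does not vanish. -/
def sectionSupport (s : Sections d F V) : Set M := closure {x | s x ≠ 0}

theorem sectionSupport_zero : sectionSupport (0 : Sections d F V) = ∅ := by
  simp [sectionSupport]

theorem sectionSupport_add (s t : Sections d F V) :
    sectionSupport (s + t) ⊆ sectionSupport s ∪ sectionSupport t := by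
  rw [sectionSupport, sectionSupport, sectionSupport, ← closure_union]
  refine closure_mono fun x hx => ?_
  by_contra h
  simp only [mem_union, mem_ofPred_eq, not_or, not_not] at h
  exact hx (by simp [h.1, h.2])

theorem sectionSupport_smul (c : ℝ) (s : Sections d F V) :
    sectionSupport (c • s) ⊆ sectionSupport s := by
  refine closure_mono fun x hx h => ?_
  exact hx (by simp [h])

variable (d F V) in
/-- `Γ₀(M, V)`: the smooth sections with compact support. -/
def compactSections : Submodule ℝ (Sections d F V) where
  carrier := {s | IsCompact (sectionSupport s)}
  zero_mem' := by simp [sectionSupport_zero]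
  add_mem' := fun {s t} hs ht =>
    (IsCompact.union hs ht).of_isClosed_subset isClosed_closure (sectionSupport_add s t)
  smul_mem' := fun c s hs => IsCompact.of_isClosed_subset hs isClosed_closure
    (sectionSupport_smul c s)

variable (F V) in
/-- `Γ_sc(M, V)`: the smooth sections with spacelike-compact support. -/
def spacelikeCompactSections [IsManifold (𝓡 d) ∞ M] (S : SpacetimeStructure d M) :
    Submodule ℝ (Sections d F V) where
  carrier := {s | S.IsSpacelikeCompact (sectionSupport s)}
  zero_mem' := ⟨∅, isCompact_empty, by simp [sectionSupport_zero]⟩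
  add_mem' := by
    rintro s t ⟨K, hK, hs⟩ ⟨L, hL, ht⟩
    refine ⟨K ∪ L, hK.union hL, (sectionSupport_add s t).trans (union_subset ?_ ?_)⟩
    · exact hs.trans (S.causalInfluence_mono subset_union_left)
    · exact ht.trans (S.causalInfluence_mono subset_union_right)
  smul_mem' := by
    rintro c s ⟨K, hK, hs⟩
    exact ⟨K, hK, (sectionSupport_smul c s).trans hs⟩

variable (d F V) in
/-- A Bosonic (symmetric) or Fermionic (antisymmetric) non-degenerate bilinear form on the fibres
of the real vector bundle `V`, depending smoothly on the base point. -/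
structure FibreForm [∀ x, IsTopologicalAddGroup (V x)] [∀ x, ContinuousSMul ℝ (V x)] where
  /-- the bilinear form on each fibre -/
  val : ∀ x : M, V x →L[ℝ] V x →L[ℝ] ℝ
  symm_or_skew : (∀ (x : M) (v w : V x), val x v w = val x w v) ∨
    (∀ (x : M) (v w : V x), val x v w = -val x w v)
  nondegenerate : ∀ (x : M) (v : V x), (∀ w : V x, val x v w = 0) → v = 0
  contMDiff : ContMDiff (𝓡 d) ((𝓡 d).prod 𝓘(ℝ, F →L[ℝ] F →L[ℝ] ℝ)) ∞
    (fun x : M => TotalSpace.mk' (F →L[ℝ] F →L[ℝ] ℝ)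
      (E := fun x : M => V x →L[ℝ] V x →L[ℝ] ℝ) x (val x))

/-- The pairing `(σ, τ) = ∫_M ⟨σ, τ⟩ vol_M` of sections. -/
def sectionPairing [∀ x, IsTopologicalAddGroup (V x)] [∀ x, ContinuousSMul ℝ (V x)]
    [IsManifold (𝓡 d) ∞ M] [T2Space M] [SecondCountableTopology M]
    [MeasurableSpace M] [BorelSpace M]
    (S : SpacetimeStructure d M) (B : FibreForm d F V) (σ τ : Sections d F V) : ℝ :=
  ∫ x, B.val x (σ x) (τ x) ∂S.g.volumeMeasure

end Sections

/-! ### Linear differential operators, formal adjoints, Green operators -/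

section Operators

variable (d : ℕ) {M : Type*} [TopologicalSpace M] [ChartedSpace (EuclideanSpace ℝ (Fin d)) M]
  [IsManifold (𝓡 d) ∞ M]
  (F : Type*) [NormedAddCommGroup F] [NormedSpace ℝ F]
  (V : M → Type*) [TopologicalSpace (TotalSpace F V)] [∀ x, TopologicalSpace (V x)]
  [∀ x, AddCommGroup (V x)] [∀ x, Module ℝ (V x)]
  [FiberBundle F V] [VectorBundle ℝ F V]

variable {d F V} in
/-- The linear operator `L` on smooth sections is a partial differential operator of order at most
`k`: near every point there are a chart `φ` and a local trivialization `Φ` in which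
`L σ = ∑_{i ≤ k} ∑_{j₁,…,j_i} A_{j₁…j_i} ∂_{j₁} ⋯ ∂_{j_i} σ` with smooth coefficients `A`. -/
def IsDiffOpOfOrderLE (k : ℕ) (L : Sections d F V →ₗ[ℝ] Sections d F V) : Prop :=
  ∀ x : M, ∃ φ ∈ IsManifold.maximalAtlas (𝓡 d) ∞ M,
    ∃ Φ : Trivialization F (TotalSpace.proj : TotalSpace F V → M), MemTrivializationAtlas Φ ∧
    ∃ U : Set M, IsOpen U ∧ x ∈ U ∧ U ⊆ φ.source ∧ U ⊆ Φ.baseSet ∧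
    ∃ A : (i : ℕ) → (Fin i → Fin d) → EuclideanSpace ℝ (Fin d) → F →L[ℝ] F,
      (∀ i ≤ k, ∀ j : Fin i → Fin d, ContDiffOn ℝ ∞ (A i j) (φ '' U)) ∧
      ∀ σ : Sections d F V, ∀ y ∈ U,
        (Φ ⟨y, L σ y⟩).2 = ∑ i ∈ Finset.range (k + 1), ∑ j : Fin i → Fin d,
          A i j (φ y) (iteratedFDeriv ℝ i (fun z => (Φ ⟨φ.symm z, σ (φ.symm z)⟩).2) (φ y)
            (fun m => EuclideanSpace.single (j m) (1 : ℝ)))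

/-- Linear partial differential operators `Γ(M, V) → Γ(M, V)` (of some finite order). -/
structure DiffOp where
  /-- the underlying linear map on sections -/
  toLin : Sections d F V →ₗ[ℝ] Sections d F V
  isDiffOp : ∃ k : ℕ, IsDiffOpOfOrderLE k toLin

namespace DiffOp

variable {d F V} (P : DiffOp d F V)

/-- A differential operator does not enlarge supports. -/
theorem support_subset (s : Sections d F V) :
    sectionSupport (P.toLin s) ⊆ sectionSupport s := by
  refine closure_minimal (fun x hx => ?_) isClosed_closure
  by_contra hxs
  obtain ⟨k, hk⟩ := P.isDiffOp
  obtain ⟨φ, -, Φ, hΦ, U, -, hxU, hUφ, hUΦ, A, -, hA⟩ := hk x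
  have hsx : ∀ᶠ y in 𝓝 x, s y = 0 := by
    filter_upwards [isClosed_closure.isOpen_compl.mem_nhds hxs] with y hy
    by_contra h
    exact hy (subset_closure h)
  have hlocal : (fun z => (Φ ⟨φ.symm z, s (φ.symm z)⟩).2) =ᶠ[𝓝 (φ x)]
      (fun z => (Φ ⟨φ.symm z, (0 : Sections d F V) (φ.symm z)⟩).2) := by
    have h1 : Tendsto φ.symm (𝓝 (φ x)) (𝓝 x) := by
      have := φ.continuousAt_symm (φ.map_source (hUφ hxU))
      rwa [ContinuousAt, φ.left_inv (hUφ hxU)] at this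
    filter_upwards [h1.eventually hsx] with z hz
    rw [hz]; rfl
  have h2 : (Φ ⟨x, P.toLin s x⟩).2 = (Φ ⟨x, P.toLin 0 x⟩).2 := by
    rw [hA s x hxU, hA 0 x hxU]
    refine Finset.sum_congr rfl fun i _ => Finset.sum_congr rfl fun j _ => ?_
    rw [(hlocal.iteratedFDeriv ℝ i).self_of_nhds]
  refine hx ?_
  have h3 : (⟨x, P.toLin s x⟩ : TotalSpace F V) = ⟨x, P.toLin 0 x⟩ := by
    refine Φ.injOn ?_ ?_ (Prod.ext ?_ h2)
    · exact Φ.mem_source.2 (hUΦ hxU)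
    · exact Φ.mem_source.2 (hUΦ hxU)
    · exact (Φ.coe_fst' (x := ⟨x, P.toLin s x⟩) (hUΦ hxU)).trans
        (Φ.coe_fst' (x := ⟨x, P.toLin 0 x⟩) (hUΦ hxU)).symm
  have h4 : P.toLin s x = P.toLin 0 x := by simpa using h3
  rw [h4, map_zero]; rfl

/-- `P` as an operator `Γ₀(M, V) → Γ₀(M, V)`. -/
def onCompact : compactSections d F V →ₗ[ℝ] compactSections d F V :=
  P.toLin.restrict fun s hs =>
    IsCompact.of_isClosed_subset hs isClosed_closure (P.support_subset s)

variable (S : SpacetimeStructure d M)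

/-- `P` as an operator `Γ_sc(M, V) → Γ_sc(M, V)`. -/
def onSpacelikeCompact :
    spacelikeCompactSections F V S →ₗ[ℝ] spacelikeCompactSections F V S :=
  P.toLin.restrict fun s ⟨K, hK, hs⟩ => ⟨K, hK, (P.support_subset s).trans hs⟩

/-- `Q` is a formal adjoint of `P`: `(Q u, v) = (u, P v)` whenever `supp u ∩ supp v` is compact. -/
def IsFormalAdjoint [∀ x, IsTopologicalAddGroup (V x)] [∀ x, ContinuousSMul ℝ (V x)]
    [T2Space M] [SecondCountableTopology M] [MeasurableSpace M] [BorelSpace M]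
    (B : FibreForm d F V) (Q : DiffOp d F V) : Prop :=
  ∀ u v : Sections d F V, IsCompact (sectionSupport u ∩ sectionSupport v) →
    sectionPairing S B (Q.toLin u) v = sectionPairing S B u (P.toLin v)

/-- An advanced Green operator `G⁺` for `P`. -/
structure AdvancedGreenOperator where
  /-- the underlying linear map -/
  toLin : compactSections d F V →ₗ[ℝ] Sections d F V
  apply_green : ∀ f : compactSections d F V, P.toLin (toLin f) = f
  green_apply : ∀ f : compactSections d F V, toLin (P.onCompact f) = f
  support_subset : ∀ f : compactSections d F V,
    sectionSupport (toLin f) ⊆ S.causalFuture (sectionSupport (f : Sections d F V))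

/-- A retarded Green operator `G⁻` for `P`. -/
structure RetardedGreenOperator where
  /-- the underlying linear map -/
  toLin : compactSections d F V →ₗ[ℝ] Sections d F V
  apply_green : ∀ f : compactSections d F V, P.toLin (toLin f) = f
  green_apply : ∀ f : compactSections d F V, toLin (P.onCompact f) = f
  support_subset : ∀ f : compactSections d F V,
    sectionSupport (toLin f) ⊆ S.causalPast (sectionSupport (f : Sections d F V))

/-- `P` is Green-hyperbolic: it admits advanced and retarded Green operators. -/
def IsGreenHyperbolic : Prop :=
  Nonempty (P.AdvancedGreenOperator S) ∧ Nonempty (P.RetardedGreenOperator S)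

variable {P S}

/-- The causal propagator `G = G⁺ - G⁻ : Γ₀(M, V) → Γ_sc(M, V)`. -/
def causalPropagator (Gp : P.AdvancedGreenOperator S) (Gm : P.RetardedGreenOperator S) :
    compactSections d F V →ₗ[ℝ] spacelikeCompactSections F V S :=
  (Gp.toLin - Gm.toLin).codRestrict (spacelikeCompactSections F V S) fun f => by
    refine ⟨sectionSupport (f : Sections d F V), f.2, ?_⟩
    rw [LinearMap.sub_apply, sub_eq_add_neg, ← neg_one_smul ℝ (Gm.toLin f)]
    refine (sectionSupport_add _ _).trans (union_subset_union (Gp.support_subset f) ?_)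
    exact (sectionSupport_smul _ _).trans (Gm.support_subset f)

end DiffOp

end Operators

end

/-! The analytic core is uniqueness: a solution `w` of `Pw = 0` supported in `J⁺(K)`, with `K`
compact, vanishes. For a test section `φ` put `ψ = G⁻φ`, with `G⁻` a retarded Green operator of the
adjoint `Q`. The supports of `ψ` and `w` meet in a closed subset of `J⁻(supp φ) ∩ J⁺(K)`, which is
compact, so `(φ, w) = (Qψ, w) = (ψ, Pw) = 0`. Non-degeneracy of the pairing gives `w = 0`; the case
of `J⁻(K)` is symmetric.

If `Gf = 0`, then `G⁺f = G⁻f` has compact support and is a preimage of `f` under `P`. If `Pu = 0`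
with `supp u ⊆ J(K)`, split `u = v + w` into a future and a past part. Then `f = Pv = -Pw` has
compact support, uniqueness yields `G⁺f = v` and `G⁻f = -w`, and `Gf = u`. The remaining inclusions
and injectivity follow directly from the Green identities.

Both the compactness and the splitting rest on one geometric fact: `J⁺(K)` lies in the interior of
`J⁺(A)` for some finite `A` (`exists_finite_causalFuture_subset`), and dually for pasts. Compactness
then reduces to finitely many diamonds, and a cutoff function exists without Cauchy surfaces or
closedness of `J±`. The fact holds because every point lies in the interior of some `J⁺({p})`, and
such interiors are stable under following causal curves. For the stability, the end of a short
causal arc is moved while its velocity is tilted into the cone (`exists_causal_perturbation`). -/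

noncomputable section

/-! ### The metric in coordinates -/

namespace LorentzMetric

variable {d : ℕ} {M : Type*} [TopologicalSpace M] [ChartedSpace (EuclideanSpace ℝ (Fin d)) M]
  [IsManifold (𝓡 d) ∞ M] (g : LorentzMetric d M)

/-- The metric read in the chart at `x`. -/
def coordForm (x : M) (z : EuclideanSpace ℝ (Fin d)) :
    EuclideanSpace ℝ (Fin d) →L[ℝ] EuclideanSpace ℝ (Fin d) →L[ℝ] ℝ :=
  ContinuousLinearMap.inCoordinates (EuclideanSpace ℝ (Fin d)) (TangentSpace (𝓡 d) : M → Type _)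
    (EuclideanSpace ℝ (Fin d) →L[ℝ] ℝ) (fun y : M => TangentSpace (𝓡 d) y →L[ℝ] ℝ)
    x ((chartAt (EuclideanSpace ℝ (Fin d)) x).symm z) x
    ((chartAt (EuclideanSpace ℝ (Fin d)) x).symm z)
    (g.val ((chartAt (EuclideanSpace ℝ (Fin d)) x).symm z))

/-- Smoothness of the metric is expressed through bundle trivializations, the volume density through
derivatives of the inverse chart; this identifies the two. -/
theorem symm_trivializationAt {x : M} {z : EuclideanSpace ℝ (Fin d)}
    (hz : z ∈ (chartAt (EuclideanSpace ℝ (Fin d)) x).target) (v : EuclideanSpace ℝ (Fin d)) :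
    (trivializationAt (EuclideanSpace ℝ (Fin d)) (TangentSpace (𝓡 d)) x).symm
      ((chartAt (EuclideanSpace ℝ (Fin d)) x).symm z) v =
    mfderiv (𝓡 d) (𝓡 d) (chartAt (EuclideanSpace ℝ (Fin d)) x).symm z v := by
  have h := TangentBundle.symmL_trivializationAt (I := 𝓡 d)
    ((chartAt (EuclideanSpace ℝ (Fin d)) x).map_target hz)
  have h2 := congrArg (fun f => f v) h
  simp only [mfld_simps, mfderivWithin_univ] at h2
  rw [OpenPartialHomeomorph.right_inv _ hz] at h2
  have hb : (chartAt (EuclideanSpace ℝ (Fin d)) x).symm z ∈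
      (trivializationAt (EuclideanSpace ℝ (Fin d)) (TangentSpace (𝓡 d) : M → Type _) x).baseSet := by
    simpa using (chartAt (EuclideanSpace ℝ (Fin d)) x).map_target hz
  exact (Trivialization.symmL_apply (R := ℝ) _ hb v).symm.trans h2

theorem coordForm_apply {x : M} {z : EuclideanSpace ℝ (Fin d)}
    (hz : z ∈ (chartAt (EuclideanSpace ℝ (Fin d)) x).target) (v w : EuclideanSpace ℝ (Fin d)) :
    g.coordForm x z v w = g.val ((chartAt (EuclideanSpace ℝ (Fin d)) x).symm z)
      (mfderiv (𝓡 d) (𝓡 d) (chartAt (EuclideanSpace ℝ (Fin d)) x).symm z v)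
      (mfderiv (𝓡 d) (𝓡 d) (chartAt (EuclideanSpace ℝ (Fin d)) x).symm z w) := by
  have h := (chartAt (EuclideanSpace ℝ (Fin d)) x).map_target hz
  rw [coordForm, inCoordinates_apply_eq₂ (by simpa using h) (by simpa using h) (by simp)]
  rw [symm_trivializationAt hz, symm_trivializationAt hz]
  simp

set_option synthInstance.maxHeartbeats 200000 in
theorem contDiffOn_coordForm (x : M) :
    ContDiffOn ℝ ∞ (g.coordForm x) (chartAt (EuclideanSpace ℝ (Fin d)) x).target := by
  rw [← contMDiffOn_iff_contDiffOn]
  intro z hz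
  have h := (chartAt (EuclideanSpace ℝ (Fin d)) x).map_target hz
  have h1 := g.contMDiff ((chartAt (EuclideanSpace ℝ (Fin d)) x).symm z)
  rw [Bundle.Trivialization.contMDiffAt_iff (e := trivializationAt
      (EuclideanSpace ℝ (Fin d) →L[ℝ] EuclideanSpace ℝ (Fin d) →L[ℝ] ℝ)
      (fun x : M => TangentSpace (𝓡 d) x →L[ℝ] TangentSpace (𝓡 d) x →L[ℝ] ℝ) x)
      (by simpa [hom_trivializationAt_source] using h)] at h1
  exact h1.2.comp_contMDiffWithinAt _ (contMDiffOn_chart_symm (I := 𝓡 d) z hz)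

theorem coordForm_chartAt {x y : M} (hy : y ∈ (chartAt (EuclideanSpace ℝ (Fin d)) x).source)
    (v w : EuclideanSpace ℝ (Fin d)) :
    g.coordForm x (chartAt (EuclideanSpace ℝ (Fin d)) x y) v w = g.val y
      ((trivializationAt (EuclideanSpace ℝ (Fin d)) (TangentSpace (𝓡 d)) x).symm y v)
      ((trivializationAt (EuclideanSpace ℝ (Fin d)) (TangentSpace (𝓡 d)) x).symm y w) := by
  rw [coordForm, OpenPartialHomeomorph.left_inv _ hy,
    inCoordinates_apply_eq₂ (by simpa using hy) (by simpa using hy) (by simp)]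
  simp

theorem coordForm_symm {x : M} {z : EuclideanSpace ℝ (Fin d)}
    (hz : z ∈ (chartAt (EuclideanSpace ℝ (Fin d)) x).target) (v w : EuclideanSpace ℝ (Fin d)) :
    g.coordForm x z v w = g.coordForm x z w v := by
  rw [coordForm_apply g hz, coordForm_apply g hz, g.symm]

end LorentzMetric

/-! ### Causal vectors and causal curves in coordinates -/

namespace SpacetimeStructure

variable {d : ℕ} {M : Type*} [TopologicalSpace M] [ChartedSpace (EuclideanSpace ℝ (Fin d)) M]
  [IsManifold (𝓡 d) ∞ M] (S : SpacetimeStructure d M)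

/-- The time orientation read in the chart at `x`. -/
def coordTime (x : M) (z : EuclideanSpace ℝ (Fin d)) : EuclideanSpace ℝ (Fin d) :=
  (trivializationAt (EuclideanSpace ℝ (Fin d)) (TangentSpace (𝓡 d)) x
    ⟨(chartAt (EuclideanSpace ℝ (Fin d)) x).symm z,
      S.timeField ((chartAt (EuclideanSpace ℝ (Fin d)) x).symm z)⟩).2

theorem continuousOn_coordTime (x : M) :
    ContinuousOn (S.coordTime x) (chartAt (EuclideanSpace ℝ (Fin d)) x).target := by
  have h1 : ContinuousOn (fun z => (⟨(chartAt (EuclideanSpace ℝ (Fin d)) x).symm z,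
      S.timeField ((chartAt (EuclideanSpace ℝ (Fin d)) x).symm z)⟩ :
        TotalSpace (EuclideanSpace ℝ (Fin d)) (TangentSpace (𝓡 d) : M → Type _)))
      (chartAt (EuclideanSpace ℝ (Fin d)) x).target :=
    S.timeField.contMDiff.continuous.comp_continuousOn
      (chartAt (EuclideanSpace ℝ (Fin d)) x).continuousOn_symm
  refine continuous_snd.comp_continuousOn ((trivializationAt (EuclideanSpace ℝ (Fin d))
    (TangentSpace (𝓡 d) : M → Type _) x).continuousOn.comp h1 fun z hz => ?_)
  have := (chartAt (EuclideanSpace ℝ (Fin d)) x).map_target hz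
  simpa [Trivialization.mem_source] using this

theorem symm_coordTime {x y : M} (hy : y ∈ (chartAt (EuclideanSpace ℝ (Fin d)) x).source) :
    (trivializationAt (EuclideanSpace ℝ (Fin d)) (TangentSpace (𝓡 d)) x).symm y
      (S.coordTime x (chartAt (EuclideanSpace ℝ (Fin d)) x y)) = S.timeField y := by
  rw [coordTime, OpenPartialHomeomorph.left_inv _ hy]
  exact Trivialization.symm_apply_apply_mk _ (by simpa using hy) _

/-- The vector `v` at the point with coordinates `z` is causal and future-directed. -/
def CoordCausal (x : M) (z v : EuclideanSpace ℝ (Fin d)) : Prop :=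
  S.g.coordForm x z v v ≤ 0 ∧ S.g.coordForm x z (S.coordTime x z) v < 0

theorem coordForm_coordTime_neg {x : M} {z : EuclideanSpace ℝ (Fin d)}
    (hz : z ∈ (chartAt (EuclideanSpace ℝ (Fin d)) x).target) :
    S.g.coordForm x z (S.coordTime x z) (S.coordTime x z) < 0 := by
  have hy := (chartAt (EuclideanSpace ℝ (Fin d)) x).map_target hz
  rw [← (chartAt (EuclideanSpace ℝ (Fin d)) x).right_inv hz, S.g.coordForm_chartAt hy,
    S.symm_coordTime hy]
  exact S.timelike _

theorem mfderiv_eq_symm_deriv {x : M} {γ : ℝ → M} {t : ℝ}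
    (hγ : ContMDiffAt 𝓘(ℝ, ℝ) (𝓡 d) ∞ γ t)
    (hx : γ t ∈ (chartAt (EuclideanSpace ℝ (Fin d)) x).source) :
    mfderiv 𝓘(ℝ, ℝ) (𝓡 d) γ t (1 : ℝ) =
      (trivializationAt (EuclideanSpace ℝ (Fin d)) (TangentSpace (𝓡 d)) x).symm (γ t)
        (deriv (chartAt (EuclideanSpace ℝ (Fin d)) x ∘ γ) t) := by
  have hd : MDifferentiableAt 𝓘(ℝ, ℝ) (𝓡 d) γ t := hγ.mdifferentiableAt (by simp)
  have h1 := TangentBundle.continuousLinearMapAt_trivializationAt (I := 𝓡 d) hx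
  have h2 := mfderiv_comp t (mdifferentiableAt_extChartAt (I := 𝓡 d) hx) hd
  have h3 : deriv (chartAt (EuclideanSpace ℝ (Fin d)) x ∘ γ) t =
      (trivializationAt (EuclideanSpace ℝ (Fin d)) (TangentSpace (𝓡 d)) x).continuousLinearMapAt ℝ
        (γ t) (mfderiv 𝓘(ℝ, ℝ) (𝓡 d) γ t (1 : ℝ)) := by
    rw [h1, ← fderiv_apply_one_eq_deriv, ← mfderiv_eq_fderiv]
    exact congrArg (fun f => f (1 : ℝ)) h2
  rw [h3]
  have hb : γ t ∈
      (trivializationAt (EuclideanSpace ℝ (Fin d)) (TangentSpace (𝓡 d) : M → Type _) x).baseSet := by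
    simpa using hx
  have h4 := Trivialization.symmL_continuousLinearMapAt (R := ℝ)
    (trivializationAt (EuclideanSpace ℝ (Fin d)) (TangentSpace (𝓡 d) : M → Type _) x)
    hb (mfderiv 𝓘(ℝ, ℝ) (𝓡 d) γ t (1 : ℝ))
  exact h4.symm.trans (Trivialization.symmL_apply (R := ℝ) _ hb _)

/-- Reduces causality of a curve near a point to one fixed chart, where velocities at different
points can be compared and added. -/
theorem isFutureCausal_mfderiv_iff {x : M} {γ : ℝ → M} {t : ℝ}
    (hγ : ContMDiffAt 𝓘(ℝ, ℝ) (𝓡 d) ∞ γ t)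
    (hx : γ t ∈ (chartAt (EuclideanSpace ℝ (Fin d)) x).source) :
    S.IsFutureCausal (x := γ t) (mfderiv 𝓘(ℝ, ℝ) (𝓡 d) γ t (1 : ℝ)) ↔
      S.CoordCausal x (chartAt (EuclideanSpace ℝ (Fin d)) x (γ t))
        (deriv (chartAt (EuclideanSpace ℝ (Fin d)) x ∘ γ) t) := by
  rw [IsFutureCausal, CoordCausal, S.g.coordForm_chartAt hx, S.g.coordForm_chartAt hx,
    S.symm_coordTime hx, mfderiv_eq_symm_deriv hγ hx]

theorem contDiffAt_chart_comp {x : M} {γ : ℝ → M} {t : ℝ}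
    (hγ : ContMDiffAt 𝓘(ℝ, ℝ) (𝓡 d) ∞ γ t)
    (hx : γ t ∈ (chartAt (EuclideanSpace ℝ (Fin d)) x).source) :
    ContDiffAt ℝ ∞ (chartAt (EuclideanSpace ℝ (Fin d)) x ∘ γ) t := by
  rw [← contMDiffAt_iff_contDiffAt]
  exact (contMDiffOn_chart.contMDiffAt
    ((chartAt (EuclideanSpace ℝ (Fin d)) x).open_source.mem_nhds hx)).comp t hγ

/-- A curve in the domain of a chart whose coordinate velocity is causal yields a causal arc. -/
theorem smoothCausalArc_of_coord (x : M) {c : ℝ → EuclideanSpace ℝ (Fin d)} {a b : ℝ}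
    (hab : a < b) (hc : ∀ t ∈ Icc a b, ContDiffAt ℝ ∞ c t)
    (hmem : ∀ t ∈ Icc a b, c t ∈ (chartAt (EuclideanSpace ℝ (Fin d)) x).target)
    (hcausal : ∀ t ∈ Icc a b, S.CoordCausal x (c t) (deriv c t)) :
    S.SmoothCausalArc ((chartAt (EuclideanSpace ℝ (Fin d)) x).symm (c a))
      ((chartAt (EuclideanSpace ℝ (Fin d)) x).symm (c b)) := by
  set e := chartAt (EuclideanSpace ℝ (Fin d)) x with he
  refine ⟨e.symm ∘ c, a, b, hab, rfl, rfl, fun t ht => ?_⟩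
  have hsm : ContMDiffAt 𝓘(ℝ, ℝ) (𝓡 d) ∞ (e.symm ∘ c) t :=
    (contMDiffOn_chart_symm.contMDiffAt (e.open_target.mem_nhds (hmem t ht))).comp t
      (hc t ht).contMDiffAt
  have hsrc : (e.symm ∘ c) t ∈ e.source := e.map_target (hmem t ht)
  refine ⟨hsm, (S.isFutureCausal_mfderiv_iff hsm hsrc).2 ?_⟩
  have hev : e ∘ e.symm ∘ c =ᶠ[𝓝 t] c := by
    filter_upwards [(hc t ht).continuousAt (e.open_target.mem_nhds (hmem t ht))] with s hs
    exact e.right_inv hs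
  rw [← he, hev.deriv_eq, show e ((e.symm ∘ c) t) = c t from e.right_inv (hmem t ht)]
  exact hcausal t ht

end SpacetimeStructure

/-! ### The volume measure is locally finite and positive on open sets -/

namespace LorentzMetric

/-- The inverse chart is controlled only on its target; the complement is null for this measure. -/
theorem aemeasurable_chart_symm {d : ℕ} {M : Type*} [TopologicalSpace M] [MeasurableSpace M]
    [BorelSpace M] (e : OpenPartialHomeomorph M (EuclideanSpace ℝ (Fin d)))
    (f : EuclideanSpace ℝ (Fin d) → ENNReal) :
    AEMeasurable e.symm
      (((volume : Measure (EuclideanSpace ℝ (Fin d))).restrict e.target).withDensity f) :=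
  (e.continuousOn_symm.aemeasurable e.open_target.measurableSet).mono_ac
    (withDensity_absolutelyContinuous _ _)

variable {d : ℕ} {M : Type*} [TopologicalSpace M] [ChartedSpace (EuclideanSpace ℝ (Fin d)) M]
  [IsManifold (𝓡 d) ∞ M] (g : LorentzMetric d M)

theorem nondegenerate {x : M} {v : TangentSpace (𝓡 d) x} (hv : ∀ w, g.val x v w = 0) : v = 0 := by
  obtain ⟨t, ht, hpos⟩ := g.lorentzian x
  by_contra h
  have := hpos v (by rw [g.symm, hv]) h
  rw [hv] at this
  exact lt_irrefl _ this

/-- A kernel vector of the Gram matrix would be `g`-orthogonal to all coordinate vectors, hence to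
everything. Consequently the volume density vanishes nowhere on the chart. -/
theorem det_coordMatrix_ne_zero {x : M} {z : EuclideanSpace ℝ (Fin d)}
    (hz : z ∈ (chartAt (EuclideanSpace ℝ (Fin d)) x).target) :
    (g.coordMatrix (chartAt (EuclideanSpace ℝ (Fin d)) x) z).det ≠ 0 := by
  intro hdet
  obtain ⟨v, hv0, hv⟩ := Matrix.exists_mulVec_eq_zero_iff.2 hdet
  have hy := (chartAt (EuclideanSpace ℝ (Fin d)) x).map_target hz
  have key : ∀ w : EuclideanSpace ℝ (Fin d), g.coordForm x z w (WithLp.toLp 2 v) = 0 := by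
    have hi : ∀ i, g.coordForm x z (EuclideanSpace.single i (1 : ℝ)) (WithLp.toLp 2 v) = 0 := by
      intro i
      have h1 := congrFun hv i
      have h2 : WithLp.toLp 2 v = ∑ j, v j • EuclideanSpace.single j (1 : ℝ) := by
        ext k
        simp [Pi.single_apply]
      rw [h2, map_sum]
      rw [Matrix.mulVec, dotProduct] at h1
      rw [Pi.zero_apply] at h1
      rw [← h1]
      refine Finset.sum_congr rfl fun j _ => ?_
      rw [map_smul, coordForm_apply g hz, smul_eq_mul, mul_comm]
      rfl
    intro w
    have h2 : w = ∑ j, w j • EuclideanSpace.single j (1 : ℝ) := by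
      ext k
      simp [Pi.single_apply]
    rw [h2]
    simp [hi]
  set e := trivializationAt (EuclideanSpace ℝ (Fin d)) (TangentSpace (𝓡 d) : M → Type _) x with he
  set y := (chartAt (EuclideanSpace ℝ (Fin d)) x).symm z with hydef
  have hyb : y ∈ e.baseSet := by simpa [he] using hy
  have h0 : e.symm y (WithLp.toLp 2 v) = 0 := by
    refine g.nondegenerate fun w => ?_
    have h3 := key (e ⟨y, w⟩).2
    rw [← (chartAt (EuclideanSpace ℝ (Fin d)) x).right_inv hz, coordForm_chartAt g hy,
      Trivialization.symm_apply_apply_mk _ hyb, g.symm] at h3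
    exact h3
  have h4 := e.apply_mk_symm hyb (WithLp.toLp 2 v)
  rw [h0] at h4
  have h5 : e ⟨y, 0⟩ = (y, 0) := e.zeroSection ℝ hyb
  exact hv0 (by simpa using (congrArg Prod.snd (h5.symm.trans h4)).symm)

theorem continuousOn_det_coordMatrix (x : M) :
    ContinuousOn (fun z => (g.coordMatrix (chartAt (EuclideanSpace ℝ (Fin d)) x) z).det)
      (chartAt (EuclideanSpace ℝ (Fin d)) x).target := by
  have h : ContinuousOn (fun z => (Matrix.of fun i j : Fin d => g.coordForm x z
      (EuclideanSpace.single i (1 : ℝ)) (EuclideanSpace.single j (1 : ℝ))).det)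
      (chartAt (EuclideanSpace ℝ (Fin d)) x).target := by
    have h1 := (g.contDiffOn_coordForm x).continuousOn
    rw [continuousOn_iff_continuous_domRestrict] at h1 ⊢
    refine Continuous.matrix_det (continuous_matrix fun i j => ?_)
    exact (h1.clm_apply continuous_const).clm_apply continuous_const
  refine h.congr fun z hz => ?_
  congr 1
  ext i j
  simp [coordMatrix, coordForm_apply g hz]

theorem continuousOn_volumeDensity (x : M) :
    ContinuousOn (fun z => ENNReal.ofReal
      (Real.sqrt |(g.coordMatrix (chartAt (EuclideanSpace ℝ (Fin d)) x) z).det|))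
      (chartAt (EuclideanSpace ℝ (Fin d)) x).target :=
  ENNReal.continuous_ofReal.comp_continuousOn
    (Real.continuous_sqrt.comp_continuousOn (g.continuousOn_det_coordMatrix x).abs)

variable [MeasurableSpace M] [BorelSpace M]

theorem chartVolume_lt_top (x : M) {K : Set M} (hK : IsCompact K) (hKm : MeasurableSet K)
    (hKx : K ⊆ (chartAt (EuclideanSpace ℝ (Fin d)) x).source) :
    g.chartVolume (chartAt (EuclideanSpace ℝ (Fin d)) x) K < ⊤ := by
  set e := chartAt (EuclideanSpace ℝ (Fin d)) x with he
  rw [chartVolume, Measure.map_apply_of_aemeasurable (aemeasurable_chart_symm e _) hKm]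
  set f : EuclideanSpace ℝ (Fin d) → ENNReal :=
    fun z => ENNReal.ofReal (Real.sqrt |(g.coordMatrix e z).det|) with hf
  have hC : IsCompact (e '' K) := hK.image_of_continuousOn (e.continuousOn.mono hKx)
  have hCt : e '' K ⊆ e.target := by
    rintro _ ⟨y, hy, rfl⟩
    exact e.map_source (hKx hy)
  -- The total function `e.symm` may also send points outside the target into `K`; these carry no
  -- mass.
  have hsub : e.symm ⁻¹' K ⊆ e '' K ∪ e.targetᶜ := by
    intro z hz
    by_cases h : z ∈ e.target
    · exact Or.inl ⟨e.symm z, hz, e.right_inv h⟩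
    · exact Or.inr h
  have h0 : (((volume : Measure (EuclideanSpace ℝ (Fin d))).restrict e.target).withDensity f)
      e.targetᶜ = 0 := by
    refine withDensity_absolutelyContinuous _ _ ?_
    rw [Measure.restrict_apply e.open_target.measurableSet.compl]
    simp
  refine ((measure_mono hsub).trans (measure_union_le _ _)).trans_lt ?_
  rw [h0, add_zero, withDensity_apply _ hC.measurableSet]
  obtain ⟨B, hB⟩ := hC.bddAbove_image
    (((Real.continuous_sqrt.comp_continuousOn (g.continuousOn_det_coordMatrix x).abs)).mono hCt)
  calc ∫⁻ z in e '' K, f z ∂(volume.restrict e.target)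
      ≤ ∫⁻ _ in e '' K, ENNReal.ofReal B ∂(volume.restrict e.target) := by
        refine setLIntegral_mono' hC.measurableSet fun z hz => ?_
        exact ENNReal.ofReal_le_ofReal (hB (mem_image_of_mem _ hz))
    _ = ENNReal.ofReal B * (volume.restrict e.target) (e '' K) := setLIntegral_const _ _
    _ < ⊤ := ENNReal.mul_lt_top ENNReal.ofReal_lt_top
        ((Measure.restrict_apply_le _ _).trans_lt hC.measure_lt_top)

theorem chartVolume_pos (x : M) {U : Set M} (hU : IsOpen U)
    (hUx : (U ∩ (chartAt (EuclideanSpace ℝ (Fin d)) x).source).Nonempty) :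
    0 < g.chartVolume (chartAt (EuclideanSpace ℝ (Fin d)) x) U := by
  set e := chartAt (EuclideanSpace ℝ (Fin d)) x with he
  rw [chartVolume, Measure.map_apply_of_aemeasurable (aemeasurable_chart_symm e _)
    hU.measurableSet, pos_iff_ne_zero, Ne, withDensity_apply_eq_zero'
    ((g.continuousOn_volumeDensity x).aemeasurable e.open_target.measurableSet)]
  have hW : IsOpen (e.target ∩ e.symm ⁻¹' U) := e.isOpen_inter_preimage_symm hU
  have hWne : (e.target ∩ e.symm ⁻¹' U).Nonempty := by
    obtain ⟨y, hyU, hy⟩ := hUx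
    exact ⟨e y, e.map_source hy, by simpa [e.left_inv hy] using hyU⟩
  intro h
  refine hW.measure_ne_zero volume hWne (le_antisymm ?_ bot_le)
  rw [← h]
  refine le_trans ?_ (Measure.le_restrict_apply _ _)
  refine measure_mono fun z hz => ⟨⟨?_, hz.2⟩, hz.1⟩
  have := g.det_coordMatrix_ne_zero hz.1
  simpa using this

variable [T2Space M] [SecondCountableTopology M]

instance : IsLocallyFiniteMeasure g.volumeMeasure := by
  have : LocallyCompactSpace M := ChartedSpace.locallyCompactSpace (EuclideanSpace ℝ (Fin d)) M
  refine ⟨fun x => ?_⟩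
  set ρ := chartPartition d M
  -- Near `x` only the finitely many `ρ i` whose closed support contains `x` can be nonzero. Each
  -- such support lies in the `i`-th chart domain, so that chart supplies a compact neighbourhood of
  -- `x` of finite volume.
  have hK : ∀ i ∈ ρ.fintsupport x, ∃ K : Set M, K ∈ 𝓝 x ∧ IsCompact K ∧
      K ⊆ (chartAt (EuclideanSpace ℝ (Fin d)) i).source := by
    intro i hi
    have hx : x ∈ (chartAt (EuclideanSpace ℝ (Fin d)) i).source :=
      chartPartition_isSubordinate d M i ((ρ.mem_fintsupport_iff x i).1 hi)
    obtain ⟨K, h1, h2, h3⟩ := local_compact_nhds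
      ((chartAt (EuclideanSpace ℝ (Fin d)) i).open_source.mem_nhds hx)
    exact ⟨K, h1, h3, h2⟩
  choose! K hKx hKc hKs using hK
  have hN : {y | ρ.finsupport y ⊆ ρ.fintsupport x} ∩ ⋂ i ∈ ρ.fintsupport x, K i ∈ 𝓝 x :=
    inter_mem (ρ.eventually_finsupport_subset x)
      ((Filter.biInter_finset_mem _).2 fun i hi => hKx i hi)
  obtain ⟨O, hON, hO, hxO⟩ := mem_nhds_iff.1 hN
  refine ⟨O, hO.mem_nhds hxO, ?_⟩
  rw [volumeMeasure, Measure.sum_apply _ hO.measurableSet, tsum_eq_sum (s := ρ.fintsupport x)]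
  · refine ENNReal.sum_lt_top.2 fun i hi => ?_
    rw [withDensity_apply _ hO.measurableSet]
    calc ∫⁻ y in O, ENNReal.ofReal (chartPartition d M i y)
          ∂g.chartVolume (chartAt (EuclideanSpace ℝ (Fin d)) i)
        ≤ ∫⁻ _ in O, 1 ∂g.chartVolume (chartAt (EuclideanSpace ℝ (Fin d)) i) := by
          refine lintegral_mono fun y => ?_
          simpa using ρ.le_one i y
      _ = g.chartVolume (chartAt (EuclideanSpace ℝ (Fin d)) i) O := setLIntegral_one _
      _ ≤ g.chartVolume (chartAt (EuclideanSpace ℝ (Fin d)) i) (K i) :=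
          measure_mono fun y hy => mem_iInter₂.1 (hON hy).2 i hi
      _ < ⊤ := g.chartVolume_lt_top i (hKc i hi) (hKc i hi).measurableSet (hKs i hi)
  · intro i hi
    rw [withDensity_apply _ hO.measurableSet]
    refine (setLIntegral_congr_fun hO.measurableSet (g := 0) fun y hy => ?_).trans (by simp)
    have : i ∉ ρ.finsupport y := fun h => hi ((hON hy).1 h)
    rw [SmoothPartitionOfUnity.mem_finsupport, Function.mem_support, not_not] at this
    simp [ρ] at this ⊢
    rw [this]

/-- Some `ρ i` is positive at a given point of `U`, and the single summand `i` already charges the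
open set `{ρ i > 0} ∩ U`. -/
instance : Measure.IsOpenPosMeasure g.volumeMeasure := by
  refine ⟨fun U hU ⟨x, hx⟩ h => ?_⟩
  obtain ⟨i, hi⟩ := (chartPartition d M).exists_pos_of_mem (mem_univ x)
  have h1 : ((g.chartVolume (chartAt (EuclideanSpace ℝ (Fin d)) i)).withDensity
      fun y => ENNReal.ofReal (chartPartition d M i y)) U = 0 :=
    by
    rw [volumeMeasure, Measure.sum_apply _ hU.measurableSet] at h
    exact ENNReal.tsum_eq_zero.1 h i
  have hcont : Continuous (chartPartition d M i) := (chartPartition d M i).contMDiff.continuous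
  have hmeas : Measurable fun y => ENNReal.ofReal (chartPartition d M i y) :=
    (ENNReal.continuous_ofReal.comp hcont).measurable
  rw [withDensity_apply_eq_zero' hmeas.aemeasurable] at h1
  have hV : IsOpen ({y | 0 < chartPartition d M i y} ∩ U) :=
    (isOpen_lt continuous_const hcont).inter hU
  have hxs : x ∈ (chartAt (EuclideanSpace ℝ (Fin d)) i).source :=
    chartPartition_isSubordinate d M i (subset_tsupport _ hi.ne')
  refine (g.chartVolume_pos i hV ⟨x, ⟨hi, hx⟩, hxs⟩).ne' (le_antisymm ?_ bot_le)
  rw [← h1]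
  refine measure_mono fun y hy => ⟨?_, hy.2⟩
  simpa using hy.1

end LorentzMetric

/-! ### Non-degeneracy of the pairing -/

section Pairing

variable {d : ℕ} {M : Type*} [TopologicalSpace M] [T2Space M]
  [SecondCountableTopology M] [ChartedSpace (EuclideanSpace ℝ (Fin d)) M]
  [IsManifold (𝓡 d) ∞ M] [MeasurableSpace M] [BorelSpace M]
  (S : SpacetimeStructure d M)
  {F : Type*} [NormedAddCommGroup F] [NormedSpace ℝ F] [FiniteDimensional ℝ F]
  {V : M → Type*} [TopologicalSpace (TotalSpace F V)] [∀ x, TopologicalSpace (V x)]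
  [∀ x, AddCommGroup (V x)] [∀ x, Module ℝ (V x)]
  [∀ x, IsTopologicalAddGroup (V x)] [∀ x, ContinuousSMul ℝ (V x)]
  [FiberBundle F V] [VectorBundle ℝ F V]
  (B : FibreForm d F V)

-- Non-degeneracy is postulated in the first argument; (anti)symmetry moves it to the second.
omit [T2Space M] [SecondCountableTopology M] [IsManifold (𝓡 d) ∞ M] [MeasurableSpace M]
  [BorelSpace M] [FiniteDimensional ℝ F] in
theorem FibreForm.exists_apply_ne_zero {x : M} {w : V x} (hw : w ≠ 0) :
    ∃ v, B.val x v w ≠ 0 := by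
  by_contra! h
  refine hw (B.nondegenerate x w fun v => ?_)
  rcases B.symm_or_skew with hB | hB
  · rw [hB, h]
  · rw [hB, h, neg_zero]

omit [T2Space M] [SecondCountableTopology M] [IsManifold (𝓡 d) ∞ M] [MeasurableSpace M]
  [BorelSpace M] [FiniteDimensional ℝ F] in
theorem FibreForm.continuousAt_apply {σ τ : ∀ x, V x} {x : M}
    (hσ : ContinuousAt (fun y => TotalSpace.mk' F y (σ y)) x)
    (hτ : ContinuousAt (fun y => TotalSpace.mk' F y (τ y)) x) :
    ContinuousAt (fun y => B.val y (σ y) (τ y)) x := by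
  have h := ContinuousAt.clm_bundle_apply₂ (F₃ := ℝ) (E₃ := Bundle.Trivial M ℝ) (b := fun y => y)
    B.contMDiff.continuous.continuousAt hσ hτ
  exact (Bundle.Trivial.trivialization M ℝ).continuousAt (by simp) |>.comp h |>.snd

/-- The pairing with compactly supported sections is non-degenerate. -/
theorem exists_sectionPairing_ne_zero [ContMDiffVectorBundle ∞ F V (𝓡 d)] {w : Sections d F V}
    (hw : w ≠ 0) : ∃ φ : compactSections d F V, sectionPairing S B φ w ≠ 0 := by
  have : LocallyCompactSpace M := ChartedSpace.locallyCompactSpace (EuclideanSpace ℝ (Fin d)) M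
  obtain ⟨x, hx⟩ : ∃ x, w x ≠ 0 := by
    by_contra! h
    exact hw (by ext x; simpa using h x)
  obtain ⟨v, hv⟩ := B.exists_apply_ne_zero hx
  set e := trivializationAt F V x with he
  have hxe : x ∈ e.baseSet := FiberBundle.mem_baseSet_trivializationAt' x
  -- The vector `v` is replaced by a member of a local frame, which comes with a smooth extension
  -- around `x`.
  obtain ⟨i, hi⟩ : ∃ i, B.val x (e.localFrame (Module.finBasis ℝ F) i x) (w x) ≠ 0 := by
    by_contra! h
    let f : V x →ₗ[ℝ] ℝ :=
      { toFun := fun v => B.val x v (w x)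
        map_add' := fun v v' => by simp
        map_smul' := fun c v => by simp }
    have h0 : f = 0 := by
      refine (e.basisAt (Module.finBasis ℝ F) hxe).ext fun i => ?_
      simpa [hxe, f] using h i
    exact hv (by simpa [f] using congrArg (fun f => f v) h0)
  set s := e.localFrame (Module.finBasis ℝ F) i with hs
  set h : M → ℝ := fun y => B.val y (s y) (w y) with hh
  have hsm : ContMDiffOn (𝓡 d) ((𝓡 d).prod 𝓘(ℝ, F)) ∞ (fun y => TotalSpace.mk' F y (s y))
      e.baseSet := e.contMDiffOn_localFrame_baseSet ∞ _ i
  have hcont : ContinuousAt h x := B.continuousAt_apply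
    (hsm.continuousOn.continuousAt (e.open_baseSet.mem_nhds hxe))
    w.contMDiff.continuous.continuousAt
  -- The constant factor `h x` normalizes the sign, so the bump-weighted integrand is non-negative.
  have hpos : ∀ᶠ y in 𝓝 x, 0 < h x * h y := by
    refine (continuousAt_const.mul hcont).eventually_const_lt (mul_self_pos.2 hi)
  obtain ⟨ψ, -, hψ⟩ := (SmoothBumpFunction.nhds_basis_tsupport (I := 𝓡 d) x).mem_iff.1
    (hpos.and (e.open_baseSet.mem_nhds hxe))
  have hφ := ContMDiffOn.smul_section_of_tsupport ψ.contMDiff.contMDiffOn e.open_baseSet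
    (fun y hy => (hψ hy).2) hsm
  set φ : Sections d F V := ⟨_, hφ⟩ with hφd
  have hφv : ∀ y, φ y = ψ y • s y := fun y => rfl
  have hsub : {y | φ y ≠ 0} ⊆ Function.support ψ := by
    intro y hy h0
    exact hy (by rw [hφv, h0, zero_smul])
  have hφc : IsCompact (sectionSupport φ) :=
    ψ.hasCompactSupport.isCompact.of_isClosed_subset isClosed_closure (closure_mono hsub)
  refine ⟨⟨φ, hφc⟩, fun h0 => ?_⟩
  set k : M → ℝ := fun y => h x * B.val y (φ y) (w y) with hk
  have hkψ : ∀ y, k y = ψ y * (h x * h y) := by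
    intro y
    simp only [hk, hh, hφv, map_smul, smul_apply, smul_eq_mul]
    ring
  have hkc : Continuous k := continuous_const.mul (continuous_iff_continuousAt.2 fun y =>
    B.continuousAt_apply φ.contMDiff.continuous.continuousAt w.contMDiff.continuous.continuousAt)
  have hint : 0 < ∫ y, k y ∂S.g.volumeMeasure := by
    refine hkc.integral_pos_of_hasCompactSupport_nonneg_nonzero (x := x) ?_ ?_ ?_
    · exact ψ.hasCompactSupport.mono fun y hy h1 => hy (by rw [hkψ, h1, zero_mul])
    · intro y
      by_cases hy : y ∈ tsupport ψ
      · rw [hkψ]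
        exact mul_nonneg ψ.nonneg (hψ hy).1.le
      · rw [hkψ, image_eq_zero_of_notMem_tsupport hy, zero_mul]
        rfl
    · rw [hkψ, ψ.eq_one, one_mul]
      exact (mul_self_pos.2 hi).ne'
  rw [integral_const_mul] at hint
  exact hint.ne' (by rw [show ∫ y, B.val y (φ y) (w y) ∂S.g.volumeMeasure = 0 from h0, mul_zero])

end Pairing

/-! ### Stability of causal vectors under tilting -/

section Perturbation

variable {E : Type*} [NormedAddCommGroup E] [NormedSpace ℝ E]

set_option synthInstance.maxHeartbeats 200000 in
/-- A causal velocity stays causal when it is pushed into the cone by `η • τ z₀` while the base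
point moves by at most a fixed multiple of `η`. -/
theorem exists_causal_perturbation {G : E → E →L[ℝ] E →L[ℝ] ℝ} {τ : E → E} {z₀ v₀ : E}
    (hG : ContDiffAt ℝ 1 G z₀) (hτ : ContinuousAt τ z₀)
    (hsymm : ∀ᶠ z in 𝓝 z₀, ∀ v w, G z v w = G z w v)
    (hv : G z₀ (τ z₀) v₀ < 0) (ht : G z₀ (τ z₀) (τ z₀) < 0) :
    ∃ κ > 0, ∃ N ∈ 𝓝 z₀, ∃ N' ∈ 𝓝 v₀, ∃ η₀ > 0, ∀ z ∈ N, ∀ z' ∈ N, ∀ v ∈ N', ∀ η : ℝ,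
      0 < η → η < η₀ → ‖z' - z‖ ≤ κ * η → G z v v ≤ 0 →
      G z' (v + η • τ z₀) (v + η • τ z₀) ≤ 0 ∧ G z' (τ z') (v + η • τ z₀) < 0 := by
  set T := τ z₀ with hT
  obtain ⟨C, s, hs, hLip⟩ := hG.exists_lipschitzOnWith
  have hGc : ContinuousAt G z₀ := hG.continuousAt
  set c : ℝ := -G z₀ T v₀ with hc
  have hcpos : 0 < c := by linarith
  have h1 : ∀ᶠ p : E × E in 𝓝 z₀ ×ˢ 𝓝 v₀, G p.1 T p.2 < -(c / 2) := by
    rw [← nhds_prod_eq]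
    have : ContinuousAt (fun p : E × E => G p.1 T p.2) (z₀, v₀) :=
      ((ContinuousAt.comp (f := Prod.fst) (x := (z₀, v₀)) hGc continuousAt_fst).clm_apply
        continuousAt_const).clm_apply continuousAt_snd
    exact this.eventually_lt_const (by simp only [hc] at hcpos ⊢; linarith)
  have h2 : ∀ᶠ z in 𝓝 z₀, G z T T < 0 :=
    ((hGc.clm_apply continuousAt_const).clm_apply continuousAt_const).eventually_lt_const ht
  have h3 : ∀ᶠ p : E × E × ℝ in 𝓝 z₀ ×ˢ 𝓝 v₀ ×ˢ 𝓝 (0 : ℝ),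
      G p.1 (τ p.1) (p.2.1 + p.2.2 • T) < 0 := by
    rw [← nhds_prod_eq, ← nhds_prod_eq]
    have : ContinuousAt (fun p : E × E × ℝ => G p.1 (τ p.1) (p.2.1 + p.2.2 • T)) (z₀, v₀, 0) := by
      have hg : ContinuousAt (fun p : E × E × ℝ => G p.1) (z₀, v₀, 0) :=
        ContinuousAt.comp (f := Prod.fst) (x := (z₀, v₀, (0 : ℝ))) hGc continuousAt_fst
      have ht : ContinuousAt (fun p : E × E × ℝ => τ p.1) (z₀, v₀, 0) :=
        ContinuousAt.comp (f := Prod.fst) (x := (z₀, v₀, (0 : ℝ))) hτ continuousAt_fst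
      exact (hg.clm_apply ht).clm_apply (by fun_prop)
    refine this.eventually_lt_const ?_
    simpa using hv
  obtain ⟨N₁, hN₁, N₁', hN₁', h1⟩ := Filter.mem_prod_iff.1 h1
  obtain ⟨N₃, hN₃, W, hW, h3⟩ := Filter.mem_prod_iff.1 h3
  obtain ⟨N₃', hN₃', I, hI, hW⟩ := Filter.mem_prod_iff.1 hW
  obtain ⟨η₁, hη₁, hη₁I⟩ := Metric.mem_nhds_iff.1 hI
  set R : ℝ := ‖v₀‖ + 1 + ‖T‖ with hR
  -- Adding `η • T` lowers `G z v v` by at least `η * c`, since `G z T v < -c / 2`. Moving the base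
  -- point by `κ * η` raises the form by at most `C * κ * η * R ^ 2 ≤ η * c`, where `C` is the
  -- Lipschitz constant of `G` and `R` bounds the tilted vector for `η ≤ 1`. The `+ 1` keeps the
  -- denominator positive.
  set κ : ℝ := c / (C * R ^ 2 + 1) with hκ
  have hden : 0 < C * R ^ 2 + 1 := by positivity
  refine ⟨κ, by positivity, s ∩ N₁ ∩ N₃ ∩ {z | G z T T < 0} ∩ {z | ∀ v w, G z v w = G z w v},
    inter_mem (inter_mem (inter_mem (inter_mem hs hN₁) hN₃) h2) hsymm,
    N₁' ∩ N₃' ∩ Metric.ball v₀ 1,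
    inter_mem (inter_mem hN₁' hN₃') (Metric.ball_mem_nhds _ one_pos), min 1 η₁,
    lt_min one_pos hη₁, ?_⟩
  rintro z ⟨⟨⟨⟨hzs, hz1⟩, hz3⟩, hz2⟩, hzsymm⟩ z' ⟨⟨⟨⟨hzs', hz1'⟩, hz3'⟩, hz2'⟩, -⟩ v
    ⟨⟨hv1, hv3⟩, hvb⟩ η hη hηlt hzz hcausal
  constructor
  · set u := v + η • T with hu
    have hlip : ‖G z' - G z‖ ≤ C * (κ * η) :=
      (hLip.norm_sub_le hzs' hzs).trans (by gcongr)
    have hun : ‖u‖ ≤ R := by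
      have e1 : ‖v‖ ≤ ‖v₀‖ + 1 := by
        have := norm_le_norm_add_norm_sub' v v₀
        rw [Metric.mem_ball, dist_eq_norm] at hvb
        linarith
      have e2 : ‖η • T‖ ≤ ‖T‖ := by
        rw [norm_smul, Real.norm_of_nonneg hη.le]
        exact mul_le_of_le_one_left (norm_nonneg _) (hηlt.le.trans (min_le_left _ _))
      exact (norm_add_le _ _).trans (by linarith)
    have hdiff : G z' u u - G z u u ≤ C * (κ * η) * R ^ 2 := by
      calc G z' u u - G z u u = (G z' - G z) u u := by simp
        _ ≤ ‖(G z' - G z) u u‖ := Real.le_norm_self _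
        _ ≤ ‖G z' - G z‖ * ‖u‖ * ‖u‖ := (G z' - G z).le_opNorm₂ u u
        _ ≤ C * (κ * η) * R * R := by gcongr
        _ = _ := by ring
    have hexp : G z u u = G z v v + 2 * η * G z T v + η ^ 2 * G z T T := by
      simp only [hu, map_add, map_smul, add_apply,
        smul_apply, smul_eq_mul, hzsymm v T]
      ring
    have hTv : G z T v < -(c / 2) := h1 (show (z, v) ∈ N₁ ×ˢ N₁' from ⟨hz1, hv1⟩)
    have hκR : C * κ * R ^ 2 ≤ c := by
      have : κ * (C * R ^ 2 + 1) = c := by rw [hκ]; field_simp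
      have hκpos : 0 < κ := by positivity
      nlinarith
    have hTT : η ^ 2 * G z T T ≤ 0 := mul_nonpos_of_nonneg_of_nonpos (sq_nonneg _) (le_of_lt hz2)
    have e3 : η * G z T v ≤ η * (-(c / 2)) := mul_le_mul_of_nonneg_left hTv.le hη.le
    have e4 : C * (κ * η) * R ^ 2 ≤ η * c := by nlinarith
    nlinarith
  · have hηI : η ∈ I := hη₁I (by
      rw [Metric.mem_ball, dist_zero_right, Real.norm_of_nonneg hη.le]
      exact hηlt.trans_le (min_le_right _ _))
    exact h3 (show (z', v, η) ∈ N₃ ×ˢ W from ⟨hz3', hW ⟨hv3, hηI⟩⟩)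

end Perturbation

/-! ### Interiors of causal futures -/

namespace SpacetimeStructure

variable {d : ℕ} {M : Type*} [TopologicalSpace M] [ChartedSpace (EuclideanSpace ℝ (Fin d)) M]
  [IsManifold (𝓡 d) ∞ M] (S : SpacetimeStructure d M)

/-- The arc from `γ t₀` to `γ t₁` can be moved to end at any point near `γ t₁`, moving its
initial point as little as desired. -/
theorem exists_dist_lt_arc_moves {γ : ℝ → M} {a b t : ℝ} (ht : t ∈ Icc a b)
    (hγ : ∀ t ∈ Icc a b, ContMDiffAt 𝓘(ℝ, ℝ) (𝓡 d) ∞ γ t ∧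
      S.IsFutureCausal (x := γ t) (mfderiv 𝓘(ℝ, ℝ) (𝓡 d) γ t (1 : ℝ))) :
    ∃ δ > 0, ∀ t₀ ∈ Icc a b, ∀ t₁ ∈ Icc a b, |t₀ - t| < δ → |t₁ - t| < δ → t₀ < t₁ →
      ∀ O ∈ 𝓝 (γ t₀), ∀ᶠ y in 𝓝 (γ t₁), ∃ p ∈ O, S.SmoothCausalArc p y := by
  set x := γ t with hx
  set e := chartAt (EuclideanSpace ℝ (Fin d)) x with he
  have hxe : x ∈ e.source := mem_chart_source _ x
  have hz0 : e x ∈ e.target := e.map_source hxe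
  have htarget := e.open_target.mem_nhds hz0
  set c : ℝ → EuclideanSpace ℝ (Fin d) := e ∘ γ with hc
  have hct : ContDiffAt ℝ ∞ c t := contDiffAt_chart_comp (hγ t ht).1 hxe
  have hvel : ContinuousAt (deriv c) t := by
    have h := (hct.fderiv_right (m := 0) (by simp)).continuousAt
    simpa only [← fderiv_apply_one_eq_deriv] using! h.clm_apply continuousAt_const
  have hcausal := (S.isFutureCausal_mfderiv_iff (hγ t ht).1 hxe).1 (hγ t ht).2
  obtain ⟨κ, hκ, N, hN, N', hN', η₀, hη₀, hpert⟩ := exists_causal_perturbation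
    (G := S.g.coordForm x) (τ := S.coordTime x) (z₀ := e x) (v₀ := deriv c t)
    (((S.g.contDiffOn_coordForm x).contDiffAt htarget).of_le (by simp))
    ((S.continuousOn_coordTime x).continuousAt htarget)
    (by filter_upwards [htarget] with z hz using S.g.coordForm_symm hz)
    hcausal.2 (S.coordForm_coordTime_neg hz0)
  set T := S.coordTime x (e x) with hT
  obtain ⟨r, hr, hrN⟩ := Metric.nhds_basis_closedBall.mem_iff.1 (inter_mem hN htarget)
  have hev : ∀ᶠ s in 𝓝 t, γ s ∈ e.source ∧ c s ∈ Metric.closedBall (e x) (r / 2) ∧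
      deriv c s ∈ N' :=
    Filter.Eventually.and ((hγ t ht).1.continuousAt (e.open_source.mem_nhds hxe))
      (Filter.Eventually.and (hct.continuousAt (Metric.closedBall_mem_nhds _ (by positivity))) (hvel hN'))
  obtain ⟨δ₁, hδ₁, hδ⟩ := Metric.eventually_nhds_iff.1 hev
  -- The second bound gives `(t₁ - t₀) * ‖T‖ ≤ κ / 2`, so a tilt of rate `η` displaces points by at
  -- most `κ * η / 2`.
  refine ⟨min δ₁ (κ / (4 * (‖T‖ + 1))), by positivity, ?_⟩
  intro t₀ ht₀ t₁ ht₁ hd₀ hd₁ hlt O hO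
  have hδs : ∀ s ∈ Icc t₀ t₁, |s - t| < min δ₁ (κ / (4 * (‖T‖ + 1))) := by
    intro s hs
    rw [abs_lt] at hd₀ hd₁ ⊢
    exact ⟨by linarith [hs.1, hd₀.1], by linarith [hs.2, hd₁.2]⟩
  have hδ' : ∀ s ∈ Icc t₀ t₁, γ s ∈ e.source ∧ c s ∈ Metric.closedBall (e x) (r / 2) ∧
      deriv c s ∈ N' := fun s hs => hδ ((hδs s hs).trans_le (min_le_left _ _))
  have hlen : (t₁ - t₀) * ‖T‖ ≤ κ / 2 := by
    have h1 : t₁ - t₀ ≤ κ / (2 * (‖T‖ + 1)) := by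
      have h0 := hd₀.trans_le (min_le_right _ _)
      have h1 := hd₁.trans_le (min_le_right _ _)
      rw [abs_lt] at h0 h1
      have : κ / (2 * (‖T‖ + 1)) = κ / (4 * (‖T‖ + 1)) + κ / (4 * (‖T‖ + 1)) := by
        field_simp; norm_num
      linarith [h0.1, h1.2]
    calc (t₁ - t₀) * ‖T‖ ≤ κ / (2 * (‖T‖ + 1)) * (‖T‖ + 1) := by
          gcongr
          linarith
      _ = κ / 2 := by field_simp
  have hm₀ : t₀ ∈ Icc t₀ t₁ := ⟨le_rfl, hlt.le⟩
  have hm₁ : t₁ ∈ Icc t₀ t₁ := ⟨hlt.le, le_rfl⟩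
  have hO' : e.symm ⁻¹' O ∈ 𝓝 (c t₀) := by
    have h1 := e.continuousAt_symm (e.map_source (hδ' t₀ hm₀).1)
    rw [ContinuousAt, e.left_inv (hδ' t₀ hm₀).1] at h1
    exact h1 hO
  obtain ⟨ρ, hρ, hρO⟩ := Metric.mem_nhds_iff.1 hO'
  obtain ⟨η, hη, hηlt⟩ : ∃ η : ℝ, 0 < η ∧ η < min η₀ (min (r / (2 * κ)) (ρ / κ)) :=
    exists_between (by positivity)
  obtain ⟨hηη₀, hηr, hηρ⟩ : η < η₀ ∧ κ * η < r / 2 ∧ κ * η < ρ := by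
    rw [lt_min_iff, lt_min_iff, lt_div_iff₀ (by positivity), lt_div_iff₀ hκ] at hηlt
    exact ⟨hηlt.1, by linarith [hηlt.2.1], by linarith [hηlt.2.2]⟩
  have hy₁ : ∀ᶠ y in 𝓝 (γ t₁), y ∈ e.source ∧ e y ∈ Metric.ball (c t₁) (κ * η / 2) :=
    Filter.Eventually.and (e.open_source.mem_nhds (hδ' t₁ hm₁).1)
      (e.continuousAt (hδ' t₁ hm₁).1 (Metric.ball_mem_nhds _ (by positivity)))
  filter_upwards [hy₁] with y hy
  -- A translation makes the curve end at `y`; the linear term vanishes at `t₁` and adds `η • T` to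
  -- the velocity. Each moves points by at most `κ * η / 2`.
  set k : ℝ → EuclideanSpace ℝ (Fin d) := fun s => c s + ((e y - c t₁) + (η * (s - t₁)) • T)
    with hk
  have hkc : ∀ s ∈ Icc t₀ t₁, ‖k s - c s‖ ≤ κ * η := by
    intro s hs
    have h1 : ‖e y - c t₁‖ ≤ κ * η / 2 := (mem_ball_iff_norm.1 hy.2).le
    have h2 : ‖(η * (s - t₁)) • T‖ ≤ κ * η / 2 := by
      rw [norm_smul, Real.norm_eq_abs, abs_mul, abs_of_pos hη, abs_of_nonpos (by linarith [hs.2])]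
      calc η * -(s - t₁) * ‖T‖ = η * ((t₁ - s) * ‖T‖) := by ring
        _ ≤ η * ((t₁ - t₀) * ‖T‖) := by gcongr; exact hs.1
        _ ≤ η * (κ / 2) := by gcongr
        _ = _ := by ring
    rw [hk]
    simp only [add_sub_cancel_left]
    exact (norm_add_le _ _).trans (by linarith)
  have hmem : ∀ s ∈ Icc t₀ t₁, k s ∈ N ∩ e.target := by
    intro s hs
    refine hrN ?_
    rw [mem_closedBall_iff_norm]
    have h1 := mem_closedBall_iff_norm.1 (hδ' s hs).2.1
    calc ‖k s - e x‖ = ‖(k s - c s) + (c s - e x)‖ := by congr 1; abel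
      _ ≤ _ := norm_add_le _ _
      _ ≤ r := by linarith [hkc s hs]
  have hcs : ∀ s ∈ Icc t₀ t₁, ContDiffAt ℝ ∞ c s := fun s hs =>
    contDiffAt_chart_comp (hγ s ⟨ht₀.1.trans hs.1, hs.2.trans ht₁.2⟩).1 (hδ' s hs).1
  have harc := S.smoothCausalArc_of_coord x (c := k) hlt
    (fun s hs => (hcs s hs).add (by fun_prop)) (fun s hs => (hmem s hs).2) (fun s hs => by
      have hsab : s ∈ Icc a b := ⟨ht₀.1.trans hs.1, hs.2.trans ht₁.2⟩
      have hder : deriv k s = deriv c s + η • T := by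
        have h1 : HasDerivAt c (deriv c s) s :=
          ((hcs s hs).differentiableAt (by simp)).hasDerivAt
        have h2 : HasDerivAt (fun s : ℝ => η * (s - t₁)) η s := by
          simpa using ((hasDerivAt_id s).sub_const t₁).const_mul η
        exact (h1.add ((h2.smul_const T).const_add _)).deriv
      rw [hder]
      have hcau := (S.isFutureCausal_mfderiv_iff (hγ s hsab).1 (hδ' s hs).1).1 (hγ s hsab).2
      have hcN : c s ∈ N := (hrN (Metric.closedBall_subset_closedBall (by linarith)
        (hδ' s hs).2.1)).1
      exact hpert (c s) hcN (k s) (hmem s hs).1 _ (hδ' s hs).2.2 η hη hηη₀ (hkc s hs) hcau.1)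
  have hk₁ : e.symm (k t₁) = y := by
    simp only [hk, sub_self, mul_zero, zero_smul, add_zero, add_sub_cancel]
    exact e.left_inv hy.1
  rw [← he, hk₁] at harc
  refine ⟨_, ?_, harc⟩
  exact hρO (mem_ball_iff_norm.2 ((hkc t₀ hm₀).trans_lt hηρ))

theorem SmoothCausalArc.causallyPrecedes {S : SpacetimeStructure d M} {p q : M}
    (h : S.SmoothCausalArc p q) : S.CausallyPrecedes p q := Relation.ReflTransGen.single h

/-- The radius `δ` works for all short subarcs near a parameter, so compactness cuts the arc into
finitely many movable pieces. If the start of a piece is interior, every point near its end is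
reached from a point of the interior. -/
theorem mem_interior_causalFuture_of_arc {A : Set M} {p q : M}
    (hp : p ∈ interior (S.causalFuture A)) (h : S.SmoothCausalArc p q) :
    q ∈ interior (S.causalFuture A) := by
  obtain ⟨γ, a, b, hab, rfl, rfl, hγ⟩ := h
  choose! δ hδpos hδ using fun t (ht : t ∈ Icc a b) => S.exists_dist_lt_arc_moves ht hγ
  obtain ⟨u, hu0, humono, ⟨m, hm⟩, hu⟩ := exists_monotone_Icc_subset_open_cover_Icc hab.le
    (c := fun t : Icc a b => {s : Icc a b | |(s : ℝ) - t| < δ t})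
    (fun t => isOpen_lt (by fun_prop) continuous_const)
    (fun s _ => mem_iUnion.2 ⟨s, by simpa using hδpos s s.2⟩)
  have key : ∀ n, γ (u n) ∈ interior (S.causalFuture A) := by
    intro n
    induction n with
    | zero => rwa [hu0]
    | succ n ih =>
      obtain ⟨t, ht⟩ := hu n
      have hle : u n ≤ u (n + 1) := humono (Nat.le_succ n)
      rcases hle.eq_or_lt with heq | hlt
      · rwa [← heq]
      have hev := hδ t t.2 (u n) (u n).2 (u (n + 1)) (u (n + 1)).2 (ht ⟨le_rfl, hle⟩)
        (ht ⟨hle, le_rfl⟩) hlt _ (isOpen_interior.mem_nhds ih)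
      rw [mem_interior_iff_mem_nhds]
      filter_upwards [hev] with y ⟨p, hp, hpy⟩
      obtain ⟨a, ha, hap⟩ := interior_subset hp
      exact ⟨a, ha, hap.tail hpy⟩
  have := key m
  rwa [hm m le_rfl] at this

theorem mem_interior_causalFuture_of_precedes {A : Set M} {p q : M}
    (hp : p ∈ interior (S.causalFuture A)) (h : S.CausallyPrecedes p q) :
    q ∈ interior (S.causalFuture A) := by
  induction h with
  | refl => exact hp
  | tail _ h ih => exact S.mem_interior_causalFuture_of_arc ih h

theorem eventually_coordCausal {x : M} {z : EuclideanSpace ℝ (Fin d)}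
    (hz : z ∈ (chartAt (EuclideanSpace ℝ (Fin d)) x).target) :
    ∀ᶠ p : EuclideanSpace ℝ (Fin d) × EuclideanSpace ℝ (Fin d) in 𝓝 (z, S.coordTime x z),
      S.CoordCausal x p.1 p.2 := by
  have htarget := (chartAt (EuclideanSpace ℝ (Fin d)) x).open_target.mem_nhds hz
  have hg : ContinuousAt (fun p : EuclideanSpace ℝ (Fin d) × EuclideanSpace ℝ (Fin d) =>
      S.g.coordForm x p.1) (z, S.coordTime x z) :=
    ContinuousAt.comp (f := Prod.fst) (x := (z, S.coordTime x z))
      ((S.g.contDiffOn_coordForm x).continuousOn.continuousAt htarget) continuousAt_fst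
  have hτ : ContinuousAt (fun p : EuclideanSpace ℝ (Fin d) × EuclideanSpace ℝ (Fin d) =>
      S.coordTime x p.1) (z, S.coordTime x z) :=
    ContinuousAt.comp (f := Prod.fst) (x := (z, S.coordTime x z))
      ((S.continuousOn_coordTime x).continuousAt htarget) continuousAt_fst
  have hneg := S.coordForm_coordTime_neg hz
  have h1 := ((hg.clm_apply continuousAt_snd).clm_apply continuousAt_snd).eventually_lt_const hneg
  have h2 := ((hg.clm_apply hτ).clm_apply continuousAt_snd).eventually_lt_const hneg
  filter_upwards [h1, h2] with p hp1 hp2 using ⟨hp1.le, hp2⟩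

/-- Take `p` slightly before `x` along the time direction `T` in a chart: straight segments from `p`
to points near `x` have velocity near `T`, hence causal. -/
theorem exists_mem_interior_causalFuture (x : M) : ∃ p, x ∈ interior (S.causalFuture {p}) := by
  set e := chartAt (EuclideanSpace ℝ (Fin d)) x with he
  have hxe : x ∈ e.source := mem_chart_source _ x
  have hz0 : e x ∈ e.target := e.map_source hxe
  set T := S.coordTime x (e x) with hT
  have hcone := S.eventually_coordCausal hz0
  rw [nhds_prod_eq] at hcone
  obtain ⟨N, hN, N', hN', hcausal⟩ := Filter.eventually_prod_iff.1 hcone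
  obtain ⟨R, hR, hRN⟩ := Metric.mem_nhds_iff.1 (Filter.Eventually.and hN (e.open_target.mem_nhds hz0))
  obtain ⟨r, hr, hrN'⟩ := Metric.mem_nhds_iff.1 hN'
  -- Chosen so that `ε * r + ε * (‖T‖ + r) = R / 2`, a bound keeping every segment in the ball of
  -- radius `R`.
  set ε : ℝ := R / (2 * (‖T‖ + 2 * r)) with hε
  have hεpos : 0 < ε := by positivity
  refine ⟨e.symm (e x - ε • T), ?_⟩
  rw [mem_interior_iff_mem_nhds]
  have hy : ∀ᶠ y in 𝓝 x, y ∈ e.source ∧ e y ∈ Metric.ball (e x) (ε * r) :=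
    Filter.Eventually.and (e.open_source.mem_nhds hxe)
      (e.continuousAt hxe (Metric.ball_mem_nhds _ (by positivity)))
  filter_upwards [hy] with y hy
  have hyn : ‖e y - e x‖ < ε * r := mem_ball_iff_norm.1 hy.2
  set v := T + ε⁻¹ • (e y - e x) with hv
  have hvn : ‖ε⁻¹ • (e y - e x)‖ < r := by
    rw [norm_smul, Real.norm_of_nonneg (by positivity), inv_mul_lt_iff₀ hεpos]
    exact hyn
  have hvN' : N' v := hrN' (mem_ball_iff_norm.2 (by simpa only [hv, ← hT, add_sub_cancel_left] using hvn))
  have hderiv : ∀ s : ℝ, deriv (fun s : ℝ => e y + s • v) s = v := fun s => by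
    simpa using (((hasDerivAt_id s).smul_const v).const_add (e y)).deriv
  have hmem : ∀ s ∈ Icc (-ε) 0, N (e y + s • v) ∧ e y + s • v ∈ e.target := by
    intro s hs
    refine hRN ?_
    rw [mem_ball_iff_norm]
    have h1 : ‖s • v‖ ≤ ε * (‖T‖ + r) := by
      rw [norm_smul, Real.norm_eq_abs, abs_of_nonpos hs.2]
      have : ‖v‖ ≤ ‖T‖ + r := (norm_add_le _ _).trans (by linarith)
      gcongr
      linarith [hs.1]
    calc ‖e y + s • v - e x‖ = ‖(e y - e x) + s • v‖ := by congr 1; abel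
      _ ≤ _ := norm_add_le _ _
      _ < ε * r + ε * (‖T‖ + r) := by linarith
      _ = R / 2 := by rw [hε]; field_simp; ring
      _ < R := by linarith
  have harc := S.smoothCausalArc_of_coord x (c := fun s => e y + s • v) (a := -ε) (b := 0)
    (by linarith) (fun s _ => by fun_prop) (fun s hs => (hmem s hs).2) (fun s hs => by
      rw [hderiv]
      exact hcausal (hmem s hs).1 hvN')
  have h0 : e.symm (e y + (0 : ℝ) • v) = y := by simpa using e.left_inv hy.1
  have h1 : e y + (-ε) • v = e x - ε • T := by
    rw [hv, smul_add, neg_smul, neg_smul, smul_inv_smul₀ hεpos.ne']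
    abel
  rw [← he, h0, h1] at harc
  exact ⟨_, rfl, harc.causallyPrecedes⟩

end SpacetimeStructure

/-! ### Time reversal and compactness of causal intersections -/

namespace SpacetimeStructure

variable {d : ℕ} {M : Type*} [TopologicalSpace M] [ChartedSpace (EuclideanSpace ℝ (Fin d)) M]
  [IsManifold (𝓡 d) ∞ M] (S : SpacetimeStructure d M)

/-- The same metric with the opposite time orientation. -/
def reverse : SpacetimeStructure d M where
  g := S.g
  timeField := -S.timeField
  timelike x := by simpa using S.timelike x

@[simp]
theorem reverse_reverse : S.reverse.reverse = S := by
  simp [reverse]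

/-- Running `γ` backwards negates its velocity, and `g(-T, -v) = g(T, v)`. Statements about futures
thereby yield those about pasts. -/
theorem SmoothCausalArc.reverse {S : SpacetimeStructure d M} {p q : M}
    (h : S.SmoothCausalArc p q) : S.reverse.SmoothCausalArc q p := by
  obtain ⟨γ, a, b, hab, rfl, rfl, hγ⟩ := h
  refine ⟨fun t => γ (-t), -b, -a, neg_lt_neg hab, by simp, by simp, fun t ht => ?_⟩
  obtain ⟨hsm, hc⟩ := hγ (-t) ⟨by linarith [ht.2], by linarith [ht.1]⟩
  have hneg : ContMDiffAt 𝓘(ℝ, ℝ) 𝓘(ℝ, ℝ) ∞ (fun s : ℝ => -s) t :=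
    (contDiff_neg.contDiffAt).contMDiffAt
  refine ⟨ContMDiffAt.comp t hsm hneg, ?_⟩
  have hd := mfderiv_comp t (hsm.mdifferentiableAt (by simp)) (hneg.mdifferentiableAt (by simp))
  have hv : mfderiv 𝓘(ℝ, ℝ) (𝓡 d) (fun s => γ (-s)) t (1 : ℝ) =
      -mfderiv 𝓘(ℝ, ℝ) (𝓡 d) γ (-t) (1 : ℝ) := by
    have h1 : mfderiv 𝓘(ℝ, ℝ) 𝓘(ℝ, ℝ) (fun s : ℝ => -s) t (1 : ℝ) = (-1 : ℝ) := by
      have h0 : fderiv ℝ (fun s : ℝ => -s) t 1 = -1 := by simp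
      rw [mfderiv_eq_fderiv]
      exact h0
    refine (congrArg (fun f => f (1 : ℝ)) hd).trans ?_
    refine (congrArg (mfderiv 𝓘(ℝ, ℝ) (𝓡 d) γ (-t)) h1).trans ?_
    exact (mfderiv 𝓘(ℝ, ℝ) (𝓡 d) γ (-t)).map_neg _
  rw [hv]
  refine ⟨?_, ?_⟩
  · simpa [SpacetimeStructure.reverse] using! hc.1
  · simpa [SpacetimeStructure.reverse] using! hc.2

theorem smoothCausalArc_reverse_iff {p q : M} :
    S.reverse.SmoothCausalArc p q ↔ S.SmoothCausalArc q p :=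
  ⟨fun h => by simpa using h.reverse, SmoothCausalArc.reverse⟩

theorem causallyPrecedes_reverse_iff {p q : M} :
    S.reverse.CausallyPrecedes p q ↔ S.CausallyPrecedes q p := by
  rw [CausallyPrecedes, CausallyPrecedes, ← Relation.reflTransGen_swap]
  have : S.reverse.SmoothCausalArc = Function.swap S.SmoothCausalArc := by
    ext p q
    exact S.smoothCausalArc_reverse_iff
  rw [this]

theorem causalFuture_reverse (A : Set M) : S.reverse.causalFuture A = S.causalPast A := by
  ext q
  simp only [causalFuture, causalPast, causallyPrecedes_reverse_iff]

/-- The causal future of a compact set is contained in the interior of the causal future of a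
finite set. -/
theorem exists_finite_causalFuture_subset {K : Set M} (hK : IsCompact K) :
    ∃ A : Set M, A.Finite ∧ S.causalFuture K ⊆ interior (S.causalFuture A) := by
  choose p hp using S.exists_mem_interior_causalFuture
  obtain ⟨t, -, ht⟩ := hK.elim_nhds_subcover (fun x => interior (S.causalFuture {p x}))
    (fun x _ => isOpen_interior.mem_nhds (hp x))
  refine ⟨p '' t, t.finite_toSet.image p, ?_⟩
  rintro q ⟨k, hk, hkq⟩
  refine S.mem_interior_causalFuture_of_precedes ?_ hkq
  obtain ⟨x, hx, hkx⟩ := mem_iUnion₂.1 (ht hk)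
  refine interior_mono ?_ hkx
  rintro y ⟨_, rfl, hy⟩
  exact ⟨_, mem_image_of_mem p hx, hy⟩

theorem exists_finite_causalPast_subset {K : Set M} (hK : IsCompact K) :
    ∃ A : Set M, A.Finite ∧ S.causalPast K ⊆ interior (S.causalPast A) := by
  simpa only [causalFuture_reverse] using S.reverse.exists_finite_causalFuture_subset hK

/-- In a globally hyperbolic spacetime, closed subsets of `J⁺(K) ∩ J⁻(L)` are compact for all
compact `K` and `L`. -/
theorem IsGloballyHyperbolic.isCompact_of_subset {S : SpacetimeStructure d M}
    (hS : S.IsGloballyHyperbolic) {K L C : Set M} (hK : IsCompact K) (hL : IsCompact L)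
    (hC : IsClosed C) (hCK : C ⊆ S.causalFuture K) (hCL : C ⊆ S.causalPast L) : IsCompact C := by
  obtain ⟨A, hA, hKA⟩ := S.exists_finite_causalFuture_subset hK
  obtain ⟨B, hB, hLB⟩ := S.exists_finite_causalPast_subset hL
  have hcomp : IsCompact (⋃ p ∈ A, ⋃ q ∈ B, S.causalFuture {p} ∩ S.causalPast {q}) :=
    hA.isCompact_biUnion fun p _ => hB.isCompact_biUnion fun q _ => hS.2 p q
  refine hcomp.of_isClosed_subset hC fun x hx => ?_
  obtain ⟨p, hp, hpx⟩ := interior_subset (hKA (hCK hx))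
  obtain ⟨q, hq, hxq⟩ := interior_subset (hLB (hCL hx))
  exact mem_biUnion hp (mem_biUnion hq ⟨⟨p, rfl, hpx⟩, ⟨q, rfl, hxq⟩⟩)

theorem causalFuture_mono {A B : Set M} (h : A ⊆ B) : S.causalFuture A ⊆ S.causalFuture B :=
  fun _ ⟨p, hp, hq⟩ => ⟨p, h hp, hq⟩

theorem causalPast_mono {A B : Set M} (h : A ⊆ B) : S.causalPast A ⊆ S.causalPast B :=
  fun _ ⟨p, hp, hq⟩ => ⟨p, h hp, hq⟩

end SpacetimeStructure

/-! ### Splitting of sections, uniqueness, and the causal propagator -/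

section Operators

variable {d : ℕ} {M : Type*} [TopologicalSpace M] [T2Space M]
  [SecondCountableTopology M] [ChartedSpace (EuclideanSpace ℝ (Fin d)) M]
  [IsManifold (𝓡 d) ∞ M]
  {S : SpacetimeStructure d M}
  {F : Type*} [NormedAddCommGroup F] [NormedSpace ℝ F]
  {V : M → Type*} [TopologicalSpace (TotalSpace F V)] [∀ x, TopologicalSpace (V x)]
  [∀ x, AddCommGroup (V x)] [∀ x, Module ℝ (V x)]
  [FiberBundle F V] [VectorBundle ℝ F V]

/-- A section with spacelike-compact support is a sum of a section supported in the future and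
one supported in the past of a compact set. -/
theorem exists_add_eq_of_mem_spacelikeCompactSections {u : Sections d F V}
    (hu : u ∈ spacelikeCompactSections F V S) :
    ∃ (K : Set M) (v w : Sections d F V), IsCompact K ∧ v + w = u ∧
      sectionSupport v ⊆ S.causalFuture K ∧ sectionSupport w ⊆ S.causalPast K := by
  have : LocallyCompactSpace M := ChartedSpace.locallyCompactSpace (EuclideanSpace ℝ (Fin d)) M
  obtain ⟨K, hK, huK⟩ := hu
  obtain ⟨A, hA, hKA⟩ := S.exists_finite_causalFuture_subset hK
  obtain ⟨B, hB, hKB⟩ := S.exists_finite_causalPast_subset hK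
  -- The two closed sets are disjoint because the interiors of `J⁺(A)` and `J⁻(B)` cover `supp u`.
  -- Being `0` or `1` on neighbourhoods of them, `χ` controls the closed supports of `χ u` and `(1 -
  -- χ) u`, not just their nonvanishing sets.
  obtain ⟨χ, hχ0, hχ1, -⟩ := exists_contMDiffMap_zero_one_nhds_of_isClosed (n := ⊤) (𝓡 d)
    (s := sectionSupport u \ interior (S.causalFuture A))
    (t := sectionSupport u \ interior (S.causalPast B))
    (isClosed_closure.sdiff isOpen_interior) (isClosed_closure.sdiff isOpen_interior) (by
      rw [Set.disjoint_left]
      rintro x ⟨hx, hxA⟩ ⟨-, hxB⟩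
      exact (huK hx).elim (fun h => hxA (hKA h)) (fun h => hxB (hKB h)))
  let v : Sections d F V := ⟨fun x => χ x • u x, χ.contMDiff.smul_section u.contMDiff⟩
  have hv : ∀ x, v x = χ x • u x := fun x => rfl
  have hw : ∀ x, (u - v) x = (1 - χ x) • u x := fun x => by
    rw [ContMDiffSection.coe_sub, Pi.sub_apply, hv, sub_smul, one_smul]
  refine ⟨A ∪ B, v, u - v, hA.isCompact.union hB.isCompact, by abel, fun x hx => ?_, fun x hx => ?_⟩
  · refine S.causalFuture_mono subset_union_left (interior_subset ?_)
    by_contra hxA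
    have hxu : x ∈ sectionSupport u :=
      closure_mono (show {y | v y ≠ 0} ⊆ {y | u y ≠ 0} from
        fun y hy h0 => hy (by rw [hv, h0, smul_zero])) hx
    have hev := (eventually_nhdsSet_iff_forall.1 hχ0) x ⟨hxu, hxA⟩
    obtain ⟨y, hy, hy0⟩ := ((mem_closure_iff_frequently.1 hx).and_eventually hev).exists
    exact hy (by rw [hv, hy0, zero_smul])
  · refine S.causalPast_mono subset_union_right (interior_subset ?_)
    by_contra hxB
    have hxu : x ∈ sectionSupport u :=
      closure_mono (show {y | (u - v) y ≠ 0} ⊆ {y | u y ≠ 0} from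
        fun y hy h0 => hy (by rw [hw, h0, smul_zero])) hx
    have hev := (eventually_nhdsSet_iff_forall.1 hχ1) x ⟨hxu, hxB⟩
    obtain ⟨y, hy, hy0⟩ := ((mem_closure_iff_frequently.1 hx).and_eventually hev).exists
    exact hy (by rw [hw, hy0, sub_self, zero_smul])

namespace DiffOp

omit [T2Space M] [SecondCountableTopology M] in
theorem onCompact_injective {P : DiffOp d F V} (Gp : P.AdvancedGreenOperator S) :
    Function.Injective P.onCompact := by
  rw [← LinearMap.ker_eq_bot, LinearMap.ker_eq_bot']
  intro f hf
  have h := Gp.green_apply f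
  rw [hf, map_zero] at h
  exact Subtype.ext h.symm

omit [T2Space M] [SecondCountableTopology M] in
/-- The kernel of the causal propagator is the range of `P` on compactly supported sections. -/
theorem ker_causalPropagator {P : DiffOp d F V} (hS : S.IsGloballyHyperbolic)
    (Gp : P.AdvancedGreenOperator S) (Gm : P.RetardedGreenOperator S) :
    LinearMap.ker (causalPropagator Gp Gm) = LinearMap.range P.onCompact := by
  ext f
  rw [LinearMap.mem_ker, LinearMap.mem_range]
  constructor
  · intro hf
    have h : Gp.toLin f = Gm.toLin f := sub_eq_zero.1 (congrArg Subtype.val hf)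
    -- The common value is supported in both the future and the past of `supp f`.
    have hc : IsCompact (sectionSupport (Gp.toLin f)) :=
      hS.isCompact_of_subset f.2 f.2 isClosed_closure (Gp.support_subset f)
        (h ▸ Gm.support_subset f)
    exact ⟨⟨Gp.toLin f, hc⟩, Subtype.ext (Gp.apply_green f)⟩
  · rintro ⟨f, rfl⟩
    refine Subtype.ext ?_
    change Gp.toLin (P.onCompact f) - Gm.toLin (P.onCompact f) = 0
    rw [Gp.green_apply, Gm.green_apply, sub_self]

variable [MeasurableSpace M] [BorelSpace M] [FiniteDimensional ℝ F]
  [∀ x, IsTopologicalAddGroup (V x)] [∀ x, ContinuousSMul ℝ (V x)]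
  [ContMDiffVectorBundle ∞ F V (𝓡 d)] {B : FibreForm d F V} {P Q : DiffOp d F V}

/-- Every test section satisfies `(φ, w) = (Qψ, w) = (ψ, Pw) = 0`. Neither `ψ` nor `w` need be
compactly supported; the adjoint identity asks only for a compact intersection. -/
theorem IsFormalAdjoint.eq_zero_of_apply_eq_zero (hadj : P.IsFormalAdjoint S B Q)
    {w : Sections d F V} (hPw : P.toLin w = 0)
    (hw : ∀ φ : compactSections d F V, ∃ ψ : Sections d F V, Q.toLin ψ = φ ∧
      IsCompact (sectionSupport ψ ∩ sectionSupport w)) : w = 0 := by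
  by_contra hne
  obtain ⟨φ, hφ⟩ := exists_sectionPairing_ne_zero S B hne
  obtain ⟨ψ, hψ, hc⟩ := hw φ
  rw [← hψ, hadj ψ w hc, hPw] at hφ
  exact hφ (by simp [sectionPairing])

/-- The opposite, retarded, Green operator is needed for `ψ`: its support lies to the past and so
meets `J⁺(K)` compactly. -/
theorem IsFormalAdjoint.eq_zero_of_support_subset_causalFuture (hS : S.IsGloballyHyperbolic)
    (hadj : P.IsFormalAdjoint S B Q) (Gm : Q.RetardedGreenOperator S) {w : Sections d F V}
    (hPw : P.toLin w = 0) {K : Set M} (hK : IsCompact K)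
    (hw : sectionSupport w ⊆ S.causalFuture K) : w = 0 :=
  hadj.eq_zero_of_apply_eq_zero hPw fun φ => ⟨Gm.toLin φ, Gm.apply_green φ,
    hS.isCompact_of_subset hK φ.2 (isClosed_closure.inter isClosed_closure)
      (inter_subset_right.trans hw) (inter_subset_left.trans (Gm.support_subset φ))⟩

theorem IsFormalAdjoint.eq_zero_of_support_subset_causalPast (hS : S.IsGloballyHyperbolic)
    (hadj : P.IsFormalAdjoint S B Q) (Gp : Q.AdvancedGreenOperator S) {w : Sections d F V}
    (hPw : P.toLin w = 0) {K : Set M} (hK : IsCompact K)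
    (hw : sectionSupport w ⊆ S.causalPast K) : w = 0 :=
  hadj.eq_zero_of_apply_eq_zero hPw fun φ => ⟨Gp.toLin φ, Gp.apply_green φ,
    hS.isCompact_of_subset φ.2 hK (isClosed_closure.inter isClosed_closure)
      (inter_subset_left.trans (Gp.support_subset φ)) (inter_subset_right.trans hw)⟩

/-- The range of the causal propagator is the space of solutions with spacelike-compact
support. -/
theorem range_causalPropagator (hS : S.IsGloballyHyperbolic) (hadj : P.IsFormalAdjoint S B Q)
    (Gp : P.AdvancedGreenOperator S) (Gm : P.RetardedGreenOperator S)
    (hQ : Q.IsGreenHyperbolic S) :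
    LinearMap.range (causalPropagator Gp Gm) = LinearMap.ker (P.onSpacelikeCompact S) := by
  obtain ⟨⟨Hp⟩, ⟨Hm⟩⟩ := hQ
  refine le_antisymm ?_ fun u hu => ?_
  · rintro _ ⟨f, rfl⟩
    refine Subtype.ext ?_
    change P.toLin (Gp.toLin f - Gm.toLin f) = 0
    rw [map_sub, Gp.apply_green, Gm.apply_green, sub_self]
  · obtain ⟨u, hsc⟩ := u
    have hPu : P.toLin u = 0 := congrArg Subtype.val hu
    obtain ⟨K, v, w, hK, rfl, hv, hw⟩ := exists_add_eq_of_mem_spacelikeCompactSections hsc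
    rw [map_add] at hPu
    have hPvw : P.toLin v = -P.toLin w := eq_neg_of_add_eq_zero_left hPu
    have hsupp : sectionSupport (P.toLin v) ⊆ sectionSupport w := by
      rw [hPvw, ← neg_one_smul ℝ]
      exact (sectionSupport_smul _ _).trans (P.support_subset w)
    -- As `Pv = -Pw`, this support lies in `J⁺(K)` through `v` and in `J⁻(K)` through `w`.
    have hfc : IsCompact (sectionSupport (P.toLin v)) :=
      hS.isCompact_of_subset hK hK isClosed_closure ((P.support_subset v).trans hv)
        (hsupp.trans hw)
    set f : compactSections d F V := ⟨P.toLin v, hfc⟩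
    -- Both terms solve `P · = f` with support in the future of the compact set `supp f ∪ K`, so
    -- uniqueness applies.
    have hp : Gp.toLin f - v = 0 := by
      refine hadj.eq_zero_of_support_subset_causalFuture hS Hm ?_ (hfc.union hK) ?_
      · rw [map_sub, Gp.apply_green, sub_self]
      · rw [sub_eq_add_neg, ← neg_one_smul ℝ v]
        refine (sectionSupport_add _ _).trans (union_subset ?_ ?_)
        · exact (Gp.support_subset f).trans (S.causalFuture_mono subset_union_left)
        · exact ((sectionSupport_smul _ _).trans hv).trans
            (S.causalFuture_mono subset_union_right)
    have hm : Gm.toLin f + w = 0 := by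
      refine hadj.eq_zero_of_support_subset_causalPast hS Hp ?_ (hfc.union hK) ?_
      · rw [map_add, Gm.apply_green]
        exact hPu
      · refine (sectionSupport_add _ _).trans (union_subset ?_ ?_)
        · exact (Gm.support_subset f).trans (S.causalPast_mono subset_union_left)
        · exact hw.trans (S.causalPast_mono subset_union_right)
    refine ⟨f, Subtype.ext ?_⟩
    change Gp.toLin f - Gm.toLin f = v + w
    rw [sub_eq_zero.1 hp, eq_neg_of_add_eq_zero_left hm, sub_neg_eq_add]

end DiffOp

end Operators

end

theorem proposition3p2 {d : ℕ} {M : Type*} [TopologicalSpace M] [T2Space M]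
    [SecondCountableTopology M] [ChartedSpace (EuclideanSpace ℝ (Fin d)) M]
    [IsManifold (𝓡 d) ∞ M] [MeasurableSpace M] [BorelSpace M]
    (S : SpacetimeStructure d M) (hS : S.IsGloballyHyperbolic)
    {F : Type*} [NormedAddCommGroup F] [NormedSpace ℝ F] [FiniteDimensional ℝ F]
    {V : M → Type*} [TopologicalSpace (TotalSpace F V)] [∀ x, TopologicalSpace (V x)]
    [∀ x, AddCommGroup (V x)] [∀ x, Module ℝ (V x)]
    [∀ x, IsTopologicalAddGroup (V x)] [∀ x, ContinuousSMul ℝ (V x)]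
    [FiberBundle F V] [VectorBundle ℝ F V] [ContMDiffVectorBundle ∞ F V (𝓡 d)]
    (B : FibreForm d F V) (P Pstar : DiffOp d F V)
    (hadj : P.IsFormalAdjoint S B Pstar)
    (hP : P.IsGreenHyperbolic S) (hPstar : Pstar.IsGreenHyperbolic S) :
    (∀ (Gp : P.AdvancedGreenOperator S) (Gm : P.RetardedGreenOperator S),
      LinearMap.ker (DiffOp.causalPropagator Gp Gm) = LinearMap.range P.onCompact ∧
      LinearMap.range (DiffOp.causalPropagator Gp Gm) =
        LinearMap.ker (P.onSpacelikeCompact S)) ∧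
    Function.Injective P.onCompact := by
  obtain ⟨⟨Gp⟩, -⟩ := hP
  exact ⟨fun Gp Gm => ⟨DiffOp.ker_causalPropagator hS Gp Gm,
    DiffOp.range_causalPropagator hS hadj Gp Gm hPstar⟩, DiffOp.onCompact_injective Gp⟩
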